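/- **Setting.** Let $d\ge 1$, let $\Omega\subset\mathbb R^d$ be open and bounded, and let $Lv=-\sum_{i,j}a_{ij}\partial_i\partial_j v+\sum_i b_i\partial_i v+c\,v$ be uniformly elliptic on $\Omega$ with bounded coefficients. Let $U$ be a real Hilbert space of functions on $\overline\Omega$ with continuous point evaluations and reproducing kernel $K$. Call $U$ *admissible* if $U\subset C^2(\Omega)\cap C(\overline\Omega)$ and the functionals $v\mapsto Lv(x)$ $(x\in\Omega)$ and $v\mapsto v(y)$ $(y\in\partial\Omega)$ are uniformly bounded on $U$. Let $\Lambda\subset U^*$ be the set of these functionals and $\|v\|_D:=\sup_{\lambda\in\Lambda}|\lambda(v)|$. A seminorm $\|\cdot\|_{WP}$ on $U$ is a *well-posedness norm with constants* $C\ge0$, $\gamma>0$ if $\|v\|_{WP}\le C\|v\|_D$ and $|v(x)|\le\gamma\|v\|_{WP}$ for all $v\in U$, $x\in\overline\Omega$. For nodes $x_1,\dots,x_M\in\overline\Omega$ the trial space is $U_M=\operatorname{span}\{K(\cdot,x_j)\}$; a nodal basis is $s_1,\dots,s_M$ spanning $U_M$ with $s_j(x_k)=\delta_{jk}$. For test functionals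 $\lambda_1,\dots,\lambda_N$ put $R_Nv=(\lambda_k(v))_k\in\mathbb R^N$ with the sup norm. **Theorem (unsymmetric kernel collocation).** 1. *Well-posedness.* If $c\ge0$ on $\Omega$, there is $C\ge0$ depending only on $\Omega,L$ with $\|v\|_{\infty,\overline\Omega}\le C\max(\|Lv\|_{\infty,\Omega},\|v\|_{\infty,\partial\Omega})$ for all $v\in C^2(\Omega)\cap C(\overline\Omega)$ for which $Lv$ is bounded on $\Omega$. Hence on every admissible $U$ the sup norm is a well-posedness norm with constants $C$ and $\gamma=1$. 2. *Sobolev spaces.* If $m\in\mathbb R$, $m>2+d/2$, and $U=H^m(\Omega)$ as a set of functions (the restrictions to $\overline\Omega$ of the continuous functions in $H^m(\mathbb R^d)$), then $U$ is admissible, and the kernel translates $K(\cdot,x_j)$ at pairwise distinct nodes are linearly independent. 3. *Stability and error bounds.* There are constants $\kappa$ and $\delta>0$, depending only on $\Omega,L$, such that for every admissible $U$ and all nodes $x_1,\dots,x_M\in\overline\Omega$ with linearly independent kernel translates, a nodal basis exists, and there are finitely many test functionals $\lambda_1,\dots,\lambda_N\in\Lambda$ such that: * $\|v\|_D\le 2\|R_Nv\|_\infty$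 for all $v\in U_M$, and for each $u^*\in U$ the residual $\|R_N(u^*-v)\|_\infty$ attains its minimum over $v\in U_M$; * for every well-posedness norm with constants $C,\gamma$, the stiffness matrix $A=(\lambda_k(s_j))_{k,j}$ in the nodal basis satisfies $\|a\|_\infty\le 2\gamma C\|Aa\|_\infty$ for all $a\in\mathbb R^M$; * for every such norm, $u^*\in U$, $C_A\ge1$, $\tilde u,v\in U_M$: if $\|R_N(u^*-\tilde u)\|_\infty\le C_A\|R_N(u^*-v)\|_\infty$, then $\|u^*-\tilde u\|_{WP}\le C(2C_A+3)\|v-u^*\|_D$; * if this residual condition holds with $v=s^*:=\sum_j u^*(x_j)s_j$, the interpolant of $u^*$, then $\max_j|u^*(x_j)-\tilde u(x_j)|\le 2\gamma C(1+C_A)\max_k|\lambda_k(u^*-s^*)|$, and $$\|u^*-\tilde u\|_{\infty,\overline\Omega}\le\gamma C(2C_A+3)\,\kappa\,S$$ for every bound $S$ on the sup norms over $\Omega$ of the derivatives of order $0,1,2$ of $u^*-s^*$. If any two points of $\Omega$ can be joined in $\Omega$ by a curve of uniformly bounded length and the fill distance $\sup_{y\in\Omega}\min_j|y-x_j|$ is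 at most $\delta$, the same holds for every bound $S$ on the sup norm over $\Omega$ of the second derivatives of $u^*-s^*$ alone. -/

import Mathlib

open Set Metric Topology MeasureTheory RKHS
open scoped ENNReal NNReal Matrix

universe u

noncomputable section

/-- Euclidean space `ℝ^d`. -/
abbrev Euc (d : ℕ) := EuclideanSpace ℝ (Fin d)

/-- The coefficients of a linear second-order differential operator
`L v = - ∑ a_ij ∂_i ∂_j v + ∑ b_i ∂_i v + c v` on `ℝ^d`. -/
structure SecondOrderOperator (d : ℕ) where
  a : Euc d → Matrix (Fin d) (Fin d) ℝ
  b : Euc d → Fin d → ℝ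
  c : Euc d → ℝ

namespace SecondOrderOperator

variable {d : ℕ}

/-- The value `L v (x)`. -/
def apply (L : SecondOrderOperator d) (v : Euc d → ℝ) (x : Euc d) : ℝ :=
  - (∑ i, ∑ j, L.a x i j *
      iteratedFDeriv ℝ 2 v x ![EuclideanSpace.single i 1, EuclideanSpace.single j 1])
    + (∑ i, L.b x i * fderiv ℝ v x (EuclideanSpace.single i 1))
    + L.c x * v x

/-- Uniform ellipticity on `Ω`, with bounded coefficients. -/
structure IsUniformlyElliptic (L : SecondOrderOperator d) (Ω : Set (Euc d)) : Prop where
  elliptic : ∃ α : ℝ, 0 < α ∧ ∀ x ∈ Ω, ∀ ξ : Fin d → ℝ,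
    α * ∑ i, ξ i ^ 2 ≤ ∑ i, ∑ j, L.a x i j * ξ i * ξ j
  bounded : ∃ B : ℝ, ∀ x ∈ Ω,
    (∀ i j, |L.a x i j| ≤ B) ∧ (∀ i, |L.b x i| ≤ B) ∧ |L.c x| ≤ B

end SecondOrderOperator

section CollocationSpace

variable {d : ℕ} (L : SecondOrderOperator d) (Ω : Set (Euc d))
variable {U : Type u} [NormedAddCommGroup U] [InnerProductSpace ℝ U]
  [RKHS ℝ U (closure Ω) ℝ]

variable {Ω} in
/-- An element of a space of functions on the closure of `Ω`, as a function on `ℝ^d`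
(zero outside the closure). On the open set `Ω` its derivatives are those of the element. -/
def extendZero (v : U) : Euc d → ℝ :=
  Function.extend Subtype.val (v : closure Ω → ℝ) 0

variable (U) in
/-- A Hilbert space of functions on the closure of `Ω` on which the strong Dirichlet problem for
`L` can be posed: its elements belong to `C²(Ω) ∩ C(closure Ω)`, and the functionals
`v ↦ L v (x)`, `x ∈ Ω`, and `v ↦ v y`, `y ∈ ∂Ω`, are uniformly bounded on it. -/
structure IsCollocationSpace : Prop where
  contDiffOn : ∀ v : U, ContDiffOn ℝ 2 (extendZero v) Ω
  continuous : ∀ v : U, Continuous (v : closure Ω → ℝ)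
  interior_bounded : ∃ k : ℝ, ∀ v : U, ∀ x ∈ Ω, |L.apply (extendZero v) x| ≤ k * ‖v‖
  boundary_bounded : ∃ k : ℝ, ∀ v : U, ∀ y ∈ frontier Ω, |extendZero v y| ≤ k * ‖v‖

variable (U) in
/-- The set `Λ ⊆ U*` of the collocation functionals `v ↦ L v (x)`, `x ∈ Ω`, and `v ↦ v y`,
`y ∈ ∂Ω`. -/
def dataFunctionals : Set (StrongDual ℝ U) :=
  {t | (∃ x ∈ Ω, ∀ v : U, t v = L.apply (extendZero v) x) ∨
    (∃ y ∈ frontier Ω, ∀ v : U, t v = extendZero v y)}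

/-- The data (semi)norm `‖v‖_D = sup_{t ∈ Λ} |t v|`. -/
def dataNorm (v : U) : ℝ :=
  ⨆ t : dataFunctionals L Ω U, |(t : StrongDual ℝ U) v|

/-- Well-posedness with constant `C` with respect to the norm `p`. -/
def IsWellPosed (p : Seminorm ℝ U) (C : ℝ) : Prop :=
  0 ≤ C ∧ ∀ v : U, p v ≤ C * dataNorm L Ω v

variable {Ω} in
/-- All point evaluations are bounded by `γ` with respect to `p`. -/
def PointEvaluationsBounded (p : Seminorm ℝ U) (γ : ℝ) : Prop :=
  0 < γ ∧ ∀ (v : U) (x : closure Ω), |v x| ≤ γ * p v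

theorem IsCollocationSpace.bddAbove_abs {L : SecondOrderOperator d} {Ω : Set (Euc d)}
    {U : Type u} [NormedAddCommGroup U] [InnerProductSpace ℝ U] [RKHS ℝ U (closure Ω) ℝ]
    (hU : IsCollocationSpace L Ω U) (hΩ : Bornology.IsBounded Ω) (v : U) :
    BddAbove (range fun x : closure Ω => |v x|) := by
  have : CompactSpace (closure Ω) := isCompact_iff_compactSpace.mp hΩ.isCompact_closure
  exact (isCompact_range (hU.continuous v).abs).bddAbove

/-- The sup norm on a space of bounded functions. -/
def supSeminorm {X : Type*} {U : Type u} [NormedAddCommGroup U] [InnerProductSpace ℝ U]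
    [RKHS ℝ U X ℝ] (hB : ∀ v : U, BddAbove (range fun x : X => |v x|)) : Seminorm ℝ U :=
  Seminorm.of (fun v => ⨆ x : X, |v x|)
    (fun v w => by
      refine Real.iSup_le (fun x => ?_) (add_nonneg
        (Real.iSup_nonneg fun _ => abs_nonneg _) (Real.iSup_nonneg fun _ => abs_nonneg _))
      have h1 : |(v + w) x| ≤ |v x| + |w x| := by
        rw [RKHS.coe_add]; exact abs_add_le _ _
      exact h1.trans (add_le_add (le_ciSup (hB v) x) (le_ciSup (hB w) x)))
    (fun r v => by
      rw [Real.norm_eq_abs, Real.mul_iSup_of_nonneg (abs_nonneg r)]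
      simp [RKHS.coe_smul, abs_mul])

end CollocationSpace

section Trial

variable {X : Type*} (U : Type u) [NormedAddCommGroup U] [InnerProductSpace ℝ U]
  [CompleteSpace U] [RKHS ℝ U X ℝ]

/-- The kernel translate `K(·, x)` of the reproducing kernel `K` of `U`. -/
def kernelTranslate (x : X) : U := RKHS.kerFun U x 1

/-- The trial space spanned by the kernel translates at the nodes `x_1, …, x_M`. -/
def trialSpace {M : ℕ} (x : Fin M → X) : Submodule ℝ U :=
  Submodule.span ℝ (range fun j => kernelTranslate U (x j))

variable {U} in
/-- `s_1, …, s_M` is the nodal (Lagrange) basis of the trial space: it spans the trial space and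
`s_j(x_k) = δ_jk` (so that it is linearly independent). -/
structure IsNodalBasis {M : ℕ} (x : Fin M → X) (s : Fin M → U) : Prop where
  span_eq : Submodule.span ℝ (range s) = trialSpace U x
  lagrange : ∀ j k, s j (x k) = if j = k then 1 else 0

end Trial

section Test

variable {U : Type u} [NormedAddCommGroup U] [InnerProductSpace ℝ U]

/-- The data of `v` restricted to the test functionals `t_1, …, t_N`. The space `Fin N → ℝ`
carries the sup norm. -/
def restrictData {N : ℕ} (t : Fin N → StrongDual ℝ U) (v : U) : Fin N → ℝ :=
  fun k => t k v

/-- The `N × M` stiffness matrix with entries `t_k(s_j)`. -/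
def stiffnessMatrix {N M : ℕ} (t : Fin N → StrongDual ℝ U) (s : Fin M → U) :
    Matrix (Fin N) (Fin M) ℝ :=
  Matrix.of fun k j => t k (s j)

end Test

/-- The real-valued continuous function `v` on `ℝ^d` belongs to the Sobolev space `H^m(ℝ^d)`. -/
def IsSobolev {d : ℕ} (m : ℝ) (v : Euc d → ℝ) : Prop :=
  Continuous v ∧ ∃ f : Lp ℂ 2 (volume : Measure (Euc d)),
    (f =ᵐ[volume] fun x => (v x : ℂ)) ∧
    TemperedDistribution.MemSobolev m 2 (Lp.toTemperedDistribution f)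

/-- The functions of `H^m(Ω)`, `m > d/2`, as continuous functions on the closure of `Ω`:
the restrictions of the functions of `H^m(ℝ^d)`. -/
def sobolevFunctions {d : ℕ} (m : ℝ) (Ω : Set (Euc d)) : Set (closure Ω → ℝ) :=
  {w | ∃ v : Euc d → ℝ, IsSobolev m v ∧ ∀ x : closure Ω, w x = v x}

/-- Any two points of `Ω` can be joined inside `Ω` by a curve of uniformly bounded length. -/
def HasFiniteInnerDiameter {d : ℕ} (Ω : Set (Euc d)) : Prop :=
  ∃ ℓ : ℝ≥0, ∀ y ∈ Ω, ∀ z ∈ Ω, ∃ g : ℝ → Euc d,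
    LipschitzOnWith ℓ g (Icc 0 1) ∧ g 0 = y ∧ g 1 = z ∧ ∀ r ∈ Icc (0 : ℝ) 1, g r ∈ Ω

/-- The fill distance `sup_{y ∈ Ω} min_j |y - x_j|` of the nodes is at most `δ`. -/
def FillDistanceLE {d M : ℕ} (Ω : Set (Euc d)) (x : Fin M → closure Ω) (δ : ℝ) : Prop :=
  ∀ y ∈ Ω, ∃ j, dist y (x j) ≤ δ

end

/-!
The theorem has three parts, each with its own reason.

**Well-posedness.** For `c ≥ 0` the sup norm bound is the weak maximum principle with an explicit
barrier. At an interior local minimum the Hessian is positive semidefinite, so its pairing with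
the (not necessarily symmetric) elliptic coefficient matrix is nonnegative; hence a function with
`L w > 0` has no negative interior minimum (`SecondOrderOperator.nonneg_of_apply_pos`). Comparing
`± v` with `m + (m + ε) ψ`, where `m = max F G` and `L ψ ≥ 1` (`exists_barrier`), gives the bound.

**Sobolev spaces.** For `m > 2 + d / 2` the Fourier transform of an `H^m` function is integrable
together with its second moment, so the function is `C²` on `ℝ^d` (`IsSobolev.contDiff`). This
makes every collocation functional finite on each element. The norm of `U` is not given by a
formula, so uniform boundedness is obtained from completeness alone: derivatives at a point are
pointwise limits of difference quotients of point evaluations, hence continuous functionals, and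
Banach–Steinhaus applies to the family of all collocation functionals
(`isCollocationSpace_of_forall_exists_contDiff`). Linear independence of the kernel translates
follows by testing against bump functions.

**Stability and errors.** The data norm restricted to the finite-dimensional trial space is a
supremum over a bounded set of functionals, so by compactness of a unit sphere finitely many of
them recover it up to a factor `2` (`Submodule.exists_finite_norming`). Combined with
well-posedness this bounds `p v` by the discrete residual on the trial space, and the stability
and error estimates follow from the triangle inequality. For the rates, the data norm of
`u - q` is bounded by its derivatives of order at most two. When `u - q` vanishes at nodes of small
fill distance, it vanishes near the centre and near `d` further points of a fixed ball in `Ω`, in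
general position, which bounds its value and gradient at the centre by its second derivatives;
integrating along curves of bounded length carries this bound to all of `Ω`
(`HasFiniteInnerDiameter.exists_norm_iteratedFDeriv_le`).
-/

/-! ### The Sobolev embedding into `C²` -/

open FourierTransform TemperedDistribution in
/-- The Fourier transform of an `H^m` function with `m > 2 + d / 2` is represented by an
integrable function with integrable second moment; applying the inverse transform exhibits the
function as a `C²` function almost everywhere. -/
theorem exists_contDiff_ae_eq_of_memSobolev {d : ℕ} {m : ℝ} (hm : 2 + (d : ℝ) / 2 < m)
    {f : Lp ℂ 2 (volume : Measure (Euc d))}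
    (hf : MemSobolev m 2 (Lp.toTemperedDistribution f)) :
    ∃ g : Euc d → ℂ, ContDiff ℝ 2 g ∧ f =ᵐ[volume] g := by
  set T : TemperedDistribution (Euc d) ℂ := Lp.toTemperedDistribution f with hT
  -- two orders of smoothness are spent on the weight `1 + ‖ξ‖ ^ 2` of the second moment
  have h1 : MemSobolev (m - 2) 2 (besselPotential (Euc d) ℂ 2 T) := by
    rw [memSobolev_besselPotential_iff]
    convert hf using 1
    ring
  obtain ⟨w, hw⟩ := h1.fourier_memL1 (by
    rw [finrank_euclideanSpace_fin]; linarith)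
  rw [fourier_besselPotential_eq_smulLeftCLM_fourier_apply] at hw
  have hT2 : 𝓕 T = smulLeftCLM ℂ (fun x : Euc d ↦ (((1 + ‖x‖ ^ 2) ^ (-1 : ℝ) : ℝ) : ℂ))
      (w : TemperedDistribution (Euc d) ℂ) := by
    rw [← hw, smulLeftCLM_smulLeftCLM_apply (by fun_prop) (by fun_prop)]
    convert! (smulLeftCLM_const 1 (𝓕 T)).symm using 1
    · simp
    · congr
      ext x
      rw [Pi.mul_apply]
      rw [← Complex.ofReal_mul, ← Real.rpow_add (by positivity)]
      norm_num
  have hwi : Integrable w volume := (memLp_one_iff_integrable).1 (Lp.memLp w)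
  -- the Fourier transform of the reflected representative of `𝓕 f` is the inverse transform
  set k : Euc d → ℂ := fun x => (((1 + ‖x‖ ^ 2) ^ (-1 : ℝ) : ℝ) : ℂ) * w (-x) with hk
  have hwn : Integrable (fun x => w (-x)) volume := hwi.comp_neg
  have hmom : ∀ n : ℕ, n ≤ 2 → Integrable (fun x => ‖x‖ ^ n * ‖k x‖) volume := by
    intro n hn
    refine hwn.mono ?_ (Filter.Eventually.of_forall fun x => ?_)
    · refine (Continuous.aestronglyMeasurable (by fun_prop)).mul (AEStronglyMeasurable.norm ?_)
      refine (Continuous.aestronglyMeasurable ?_).mul hwn.aestronglyMeasurable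
      exact Complex.continuous_ofReal.comp
        ((by fun_prop : Continuous fun x : Euc d => 1 + ‖x‖ ^ 2).rpow_const
          fun x => Or.inl (by positivity))
    · rw [hk]
      simp only [norm_mul, norm_pow, norm_norm, Complex.norm_real]
      rw [← mul_assoc]
      refine mul_le_of_le_one_left (norm_nonneg _) ?_
      rw [Real.norm_of_nonneg (by positivity : (0 : ℝ) ≤ (1 + ‖x‖ ^ 2) ^ (-1 : ℝ)), Real.rpow_neg_one,
        ← div_eq_mul_inv, div_le_one (by positivity)]
      have := norm_nonneg x
      interval_cases n <;> nlinarith [sq_nonneg (‖x‖ - 1)]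
  have hki : Integrable k volume := by
    have := hmom 0 (by norm_num)
    simp only [pow_zero, one_mul] at this
    rwa [integrable_norm_iff] at this
    refine (Continuous.aestronglyMeasurable ?_).mul hwn.aestronglyMeasurable
    exact Complex.continuous_ofReal.comp
        ((by fun_prop : Continuous fun x : Euc d => 1 + ‖x‖ ^ 2).rpow_const
          fun x => Or.inl (by positivity))
  have hC : ContDiff ℝ 2 (𝓕 k) := by
    have := Real.contDiff_fourier (f := k) (N := 2) (fun n hn => hmom n (by exact_mod_cast hn))
    exact_mod_cast this
  refine ⟨𝓕 k, hC, ?_⟩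
  refine ae_eq_of_integral_contDiff_smul_eq
    ((Lp.memLp f).locallyIntegrable (by norm_num)) hC.continuous.locallyIntegrable ?_
  intro g hg hgc
  have hg₁ : HasCompactSupport (Complex.ofRealCLM ∘ g) := hgc.comp_left rfl
  have hg₂ : ContDiff ℝ (⊤ : ℕ∞) (Complex.ofRealCLM ∘ g) := by fun_prop
  set φ : SchwartzMap (Euc d) ℂ := hg₁.toSchwartzMap hg₂ with hφ
  -- move both transforms onto the test function, cancel the weight, then use self-adjointness
  have e1 : ∫ x, g x • f x = T φ := by
    simp [hT, hφ]
  have e2 : T φ = ∫ x, (𝓕⁻ φ : SchwartzMap (Euc d) ℂ) x *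
      ((((1 + ‖x‖ ^ 2) ^ (-1 : ℝ) : ℝ) : ℂ) * w x) := by
    have : T = 𝓕⁻ (𝓕 T) := (fourierInv_fourier_eq T).symm
    rw [this, fourierInv_apply, hT2, smulLeftCLM_apply_apply, Lp.toTemperedDistribution_apply]
    refine integral_congr_ae (Filter.Eventually.of_forall fun x => ?_)
    simp only
    rw [SchwartzMap.smulLeftCLM_apply_apply (by fun_prop)]
    simp only [smul_eq_mul]
    ring
  have e3 : ∫ x, (𝓕⁻ φ : SchwartzMap (Euc d) ℂ) x *
      ((((1 + ‖x‖ ^ 2) ^ (-1 : ℝ) : ℝ) : ℂ) * w x) = ∫ x, (𝓕 (φ : Euc d → ℂ)) x * k x := by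
    rw [← integral_neg_eq_self]
    refine integral_congr_ae (Filter.Eventually.of_forall fun x => ?_)
    simp only [hk, norm_neg]
    rw [SchwartzMap.fourierInv_coe, Real.fourierInv_eq_fourier_neg, neg_neg]
  have e4 : ∫ x, (𝓕 (φ : Euc d → ℂ)) x * k x = ∫ x, φ x * 𝓕 k x := by
    simpa using! (VectorFourier.integral_fourierIntegral_smul_eq_flip (L := innerₗ (Euc d))
      Real.continuous_fourierChar continuous_inner (φ.integrable (μ := volume)) hki)
  rw [e1, e2, e3, e4]
  refine integral_congr_ae (Filter.Eventually.of_forall fun x => ?_)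
  simp [hφ]

/-- Sobolev embedding `H^m(ℝ^d) ⊆ C²(ℝ^d)` for `m > 2 + d / 2`. -/
theorem IsSobolev.contDiff {d : ℕ} {m : ℝ} (hm : 2 + (d : ℝ) / 2 < m) {v : Euc d → ℝ}
    (hv : IsSobolev m v) : ContDiff ℝ 2 v := by
  obtain ⟨hvc, f, hfv, hf⟩ := hv
  obtain ⟨g, hg, hfg⟩ := exists_contDiff_ae_eq_of_memSobolev hm hf
  have h : (fun x => (v x : ℂ)) = g :=
    (Complex.continuous_ofReal.comp hvc).ae_eq_iff_eq volume hg.continuous |>.1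
      (hfv.symm.trans hfg)
  have h2 : v = fun x => (g x).re := by
    ext x; rw [← h]; simp
  rw [h2]
  exact Complex.reCLM.contDiff.comp hg

theorem isSobolev_of_contDiff_of_hasCompactSupport {d : ℕ} (m : ℝ) {v : Euc d → ℝ}
    (hv : ContDiff ℝ (⊤ : ℕ∞) v) (hc : HasCompactSupport v) : IsSobolev m v := by
  have h₁ : HasCompactSupport (Complex.ofRealCLM ∘ v) := hc.comp_left rfl
  have h₂ : ContDiff ℝ (⊤ : ℕ∞) (Complex.ofRealCLM ∘ v) := by fun_prop
  refine ⟨hv.continuous, (h₁.toSchwartzMap h₂).toLp 2, ?_, ?_⟩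
  · filter_upwards [(h₁.toSchwartzMap h₂).coeFn_toLp 2 volume] with x hx
    rw [hx]
    simp
  · rw [Lp.toTemperedDistribution_toLp_eq]
    exact SchwartzMap.memSobolev _

/-! ### Linearity and bounds for the differential operator -/

namespace SecondOrderOperator

variable {d : ℕ} (L : SecondOrderOperator d)

theorem apply_add {v w : Euc d → ℝ} {x : Euc d} (hv : ContDiffAt ℝ 2 v x)
    (hw : ContDiffAt ℝ 2 w x) : L.apply (v + w) x = L.apply v x + L.apply w x := by
  unfold apply
  rw [iteratedFDeriv_add_apply hv hw,
    fderiv_add (hv.differentiableAt (by norm_num)) (hw.differentiableAt (by norm_num))]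
  simp only [add_apply, Pi.add_apply,
    mul_add, Finset.sum_add_distrib]
  ring

theorem apply_const_smul {v : Euc d → ℝ} {x : Euc d} (r : ℝ) (hv : ContDiffAt ℝ 2 v x) :
    L.apply (r • v) x = r * L.apply v x := by
  unfold apply
  rw [iteratedFDeriv_const_smul_apply hv,
    fderiv_const_smul (hv.differentiableAt (by norm_num))]
  simp only [smul_apply, Pi.smul_apply,
    smul_eq_mul, mul_add, Finset.mul_sum, mul_neg]
  simp only [mul_left_comm _ r]

theorem apply_const (r : ℝ) (x : Euc d) : L.apply (fun _ => r) x = L.c x * r := by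
  simp [apply, iteratedFDeriv_two_apply]

/-- The values of `L v` are controlled by the derivatives of `v` of order at most two, with a
constant depending only on the bound for the coefficients. -/
theorem IsUniformlyElliptic.exists_abs_apply_le {L : SecondOrderOperator d} {Ω : Set (Euc d)}
    (hL : L.IsUniformlyElliptic Ω) :
    ∃ κ : ℝ, 1 ≤ κ ∧ ∀ (v : Euc d → ℝ) (S : ℝ), ∀ x ∈ Ω,
      (∀ k ≤ 2, ‖iteratedFDeriv ℝ k v x‖ ≤ S) → |L.apply v x| ≤ κ * S := by
  obtain ⟨B, hB⟩ := hL.bounded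
  refine ⟨d * d * |B| + d * |B| + |B| + 1, ?_, ?_⟩
  · have : 0 ≤ (d : ℝ) * d * |B| + d * |B| + |B| := by positivity
    linarith
  intro v S x hx hS
  obtain ⟨ha, hb, hc⟩ := hB x hx
  have hBB := le_abs_self B
  have hS0 : 0 ≤ S := (norm_nonneg _).trans (hS 0 (by norm_num))
  have he : ∀ i : Fin d, ‖(EuclideanSpace.single i (1 : ℝ) : Euc d)‖ = 1 := fun i => by simp
  have h2 : ∀ i j : Fin d, |L.a x i j *
      iteratedFDeriv ℝ 2 v x ![EuclideanSpace.single i 1, EuclideanSpace.single j 1]| ≤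
      |B| * S := by
    intro i j
    rw [abs_mul]
    refine mul_le_mul ((ha i j).trans hBB) ?_ (abs_nonneg _) (abs_nonneg _)
    refine ((iteratedFDeriv ℝ 2 v x).le_opNorm _).trans ?_
    simpa [Fin.prod_univ_two] using hS 2 le_rfl
  have h1 : ∀ i : Fin d, |L.b x i * fderiv ℝ v x (EuclideanSpace.single i 1)| ≤ |B| * S := by
    intro i
    rw [abs_mul]
    refine mul_le_mul ((hb i).trans hBB) ?_ (abs_nonneg _) (abs_nonneg _)
    refine ((fderiv ℝ v x).le_opNorm _).trans ?_
    rw [he, mul_one, ← norm_iteratedFDeriv_one]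
    exact hS 1 (by norm_num)
  have h0 : |L.c x * v x| ≤ |B| * S := by
    rw [abs_mul]
    refine mul_le_mul (hc.trans hBB) ?_ (abs_nonneg _) (abs_nonneg _)
    simpa using hS 0 (by norm_num)
  have s2 : |∑ i, ∑ j, L.a x i j *
      iteratedFDeriv ℝ 2 v x ![EuclideanSpace.single i 1, EuclideanSpace.single j 1]| ≤
      d * (d * (|B| * S)) := by
    refine (Finset.abs_sum_le_sum_abs _ _).trans ?_
    refine (Finset.sum_le_card_nsmul _ _ (d * (|B| * S)) fun i _ => ?_).trans (by simp)
    refine (Finset.abs_sum_le_sum_abs _ _).trans ?_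
    exact (Finset.sum_le_card_nsmul _ _ (|B| * S) fun j _ => h2 i j).trans (by simp)
  have s1 : |∑ i, L.b x i * fderiv ℝ v x (EuclideanSpace.single i 1)| ≤ d * (|B| * S) := by
    refine (Finset.abs_sum_le_sum_abs _ _).trans ?_
    exact (Finset.sum_le_card_nsmul _ _ (|B| * S) fun j _ => h1 j).trans (by simp)
  unfold apply
  refine (abs_add_three _ _ _).trans ?_
  rw [abs_neg]
  nlinarith

end SecondOrderOperator

/-! ### The maximum principle -/

/-- The second derivative of a `C²` function at a local minimum is positive semidefinite. -/
theorem IsLocalMin.fderiv_fderiv_apply_self_nonneg {E : Type*} [NormedAddCommGroup E]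
    [NormedSpace ℝ E] {f : E → ℝ} {x : E} (hmin : IsLocalMin f x) (hf : ContDiffAt ℝ 2 f x)
    (ξ : E) : 0 ≤ fderiv ℝ (fderiv ℝ f) x ξ ξ := by
  set g : ℝ → ℝ := fun t => f (x + t • ξ) with hg
  have hline : ∀ t : ℝ, HasDerivAt (fun t : ℝ => x + t • ξ) ξ t := fun t => by
    simpa using ((hasDerivAt_id t).smul_const ξ).const_add x
  have hcont : ContinuousAt (fun t : ℝ => x + t • ξ) 0 := (hline 0).continuousAt
  have h0 : x + (0 : ℝ) • ξ = x := by simp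
  have hev : ∀ᶠ y in 𝓝 x, ContDiffAt ℝ 2 f y := hf.eventually (by simp)
  have hd : deriv g =ᶠ[𝓝 0] fun t => fderiv ℝ f (x + t • ξ) ξ := by
    have := hcont.eventually (p := fun y => ContDiffAt ℝ 2 f y) (by simpa using hev)
    filter_upwards [this] with t ht
    exact ((ht.differentiableAt (by norm_num)).hasFDerivAt.comp_hasDerivAt t (hline t)).deriv
  have hfd : HasFDerivAt (fderiv ℝ f) (fderiv ℝ (fderiv ℝ f) x) x :=
    ((hf.fderiv_right (m := 1) (by norm_num)).differentiableAt (by norm_num)).hasFDerivAt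
  have hdd : deriv (deriv g) 0 = fderiv ℝ (fderiv ℝ f) x ξ ξ := by
    rw [hd.deriv_eq]
    have h1 : HasDerivAt (fun t : ℝ => fderiv ℝ f (x + t • ξ)) (fderiv ℝ (fderiv ℝ f) x ξ) 0 :=
      HasFDerivAt.comp_hasDerivAt (0 : ℝ) (by rw [h0]; exact hfd) (hline 0)
    exact (h1.clm_apply (hasDerivAt_const (0 : ℝ) ξ)).deriv.trans (by simp)
  have hgmin : IsLocalMin g 0 := by
    have : IsLocalMin f (x + (0 : ℝ) • ξ) := by rw [h0]; exact hmin
    exact this.comp_continuous (g := fun t : ℝ => x + t • ξ) hcont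
  have hgc : ContinuousAt g 0 := by
    refine ContinuousAt.comp (f := fun t : ℝ => x + t • ξ) ?_ hcont
    rw [h0]; exact hf.continuousAt
  by_contra! hneg
  -- a negative second derivative makes the minimum a maximum too, so `g` is locally constant
  have hgmax : IsLocalMax g 0 :=
    isLocalMax_of_deriv_deriv_neg (by rw [hdd]; exact hneg) hgmin.deriv_eq_zero hgc
  have hconst : g =ᶠ[𝓝 0] fun _ => g 0 := by
    filter_upwards [hgmin, hgmax] with t h1 h2 using le_antisymm h2 h1
  have : deriv (deriv g) 0 = 0 := by
    rw [hconst.deriv.deriv_eq]; simp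
  rw [hdd] at this
  linarith

/-- The pairing `∑ a_ij h_ij` of a matrix with nonnegative quadratic form (not necessarily
symmetric) with a positive semidefinite matrix is nonnegative. -/
theorem Matrix.PosSemidef.sum_sum_mul_nonneg {n : Type*} [Fintype n]
    {A H : Matrix n n ℝ} (hH : H.PosSemidef)
    (hA : ∀ ξ : n → ℝ, 0 ≤ ∑ i, ∑ j, A i j * ξ i * ξ j) : 0 ≤ ∑ i, ∑ j, A i j * H i j := by
  classical
  open scoped MatrixOrder in
  obtain ⟨B, rfl⟩ := CStarAlgebra.nonneg_iff_eq_star_mul_self.mp hH.nonneg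
  have : ∑ i, ∑ j, A i j * (star B * B) i j = ∑ k, ∑ i, ∑ j, A i j * B k i * B k j := by
    simp only [Matrix.mul_apply, Matrix.star_apply, star_trivial, Finset.mul_sum]
    rw [Finset.sum_comm]
    refine Eq.trans (Finset.sum_congr rfl fun j _ => Finset.sum_comm) ?_
    rw [Finset.sum_comm]
    refine Finset.sum_congr rfl fun k _ => ?_
    rw [Finset.sum_comm]
    simp only [mul_assoc]
  rw [this]
  exact Finset.sum_nonneg fun k _ => hA _

namespace SecondOrderOperator

variable {d : ℕ} {L : SecondOrderOperator d} {Ω : Set (Euc d)}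

/-- Weak minimum principle in its strict form: a function with `L w > 0` has no negative interior
minimum. -/
theorem nonneg_of_apply_pos (hopen : IsOpen Ω) (hbdd : Bornology.IsBounded Ω)
    (hL : L.IsUniformlyElliptic Ω) (hc : ∀ x ∈ Ω, 0 ≤ L.c x) {w : Euc d → ℝ}
    (hw : ContDiffOn ℝ 2 w Ω) (hwc : ContinuousOn w (closure Ω))
    (hpos : ∀ x ∈ Ω, 0 < L.apply w x) (hbd : ∀ y ∈ frontier Ω, 0 ≤ w y) :
    ∀ x ∈ closure Ω, 0 ≤ w x := by
  intro x hx
  obtain ⟨z, hz, hmin⟩ := hbdd.isCompact_closure.exists_isMinOn ⟨x, hx⟩ hwc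
  refine le_trans ?_ (hmin hx)
  by_contra! hneg
  have hzΩ : z ∈ Ω := by
    by_contra h
    exact absurd (hbd z ⟨hz, by rwa [hopen.interior_eq]⟩) (not_le.2 hneg)
  have hloc : IsLocalMin w z := by
    filter_upwards [hopen.mem_nhds hzΩ] with y hy using hmin (subset_closure hy)
  have hC : ContDiffAt ℝ 2 w z := hw.contDiffAt (hopen.mem_nhds hzΩ)
  have hsymm : IsSymmSndFDerivAt ℝ w z := hC.isSymmSndFDerivAt (by simp)
  set H : Matrix (Fin d) (Fin d) ℝ := Matrix.of fun i j =>
    fderiv ℝ (fderiv ℝ w) z (EuclideanSpace.single i 1) (EuclideanSpace.single j 1) with hH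
  have hHpos : H.PosSemidef := by
    refine Matrix.PosSemidef.of_dotProduct_mulVec_nonneg ?_ fun ξ => ?_
    · ext i j
      simp only [hH, Matrix.conjTranspose_apply, Matrix.of_apply, star_trivial]
      exact hsymm _ _
    · have := hloc.fderiv_fderiv_apply_self_nonneg hC
        (∑ i, ξ i • (EuclideanSpace.single i 1 : Euc d))
      refine this.trans_eq ?_
      simp only [map_sum, map_smul, sum_apply, smul_apply,
        smul_eq_mul, dotProduct, Matrix.mulVec, hH, Matrix.of_apply, star_trivial,
        Finset.mul_sum]
      rw [Finset.sum_comm]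
      refine Finset.sum_congr rfl fun i _ => Finset.sum_congr rfl fun j _ => by ring
  obtain ⟨α, hα, hell⟩ := hL.elliptic
  have htr := hHpos.sum_sum_mul_nonneg (A := L.a z) fun ξ =>
    (mul_nonneg hα.le (Finset.sum_nonneg fun i _ => sq_nonneg (ξ i))).trans (hell z hzΩ ξ)
  have hLw := hpos z hzΩ
  have hcw : L.c z * w z ≤ 0 := mul_nonpos_of_nonneg_of_nonpos (hc z hzΩ) hneg.le
  simp only [apply, iteratedFDeriv_two_apply, hloc.fderiv_eq_zero] at hLw
  simp only [hH, Matrix.of_apply] at htr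
  simp at hLw
  linarith

/-- Barrier function: for `c ≥ 0`, a suitable multiple of `exp (λ R) - exp (λ x₀)` satisfies
`L ψ ≥ 1`, the second-order term dominating the first-order one for large `λ`. -/
theorem exists_barrier (hd : 0 < d) (hbdd : Bornology.IsBounded Ω)
    (hL : L.IsUniformlyElliptic Ω) (hc : ∀ x ∈ Ω, 0 ≤ L.c x) :
    ∃ (ψ : Euc d → ℝ) (K : ℝ), 0 ≤ K ∧ ContDiff ℝ 2 ψ ∧
      (∀ x ∈ closure Ω, 0 ≤ ψ x ∧ ψ x ≤ K) ∧ ∀ x ∈ Ω, 1 ≤ L.apply ψ x := by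
  obtain ⟨α, hα, hell⟩ := hL.elliptic
  obtain ⟨B, hB⟩ := hL.bounded
  obtain ⟨R, hR⟩ := hbdd.closure.exists_norm_le
  set i₀ : Fin d := ⟨0, hd⟩
  set l : ℝ := (|B| + 1) / α with hl
  have hlpos : 0 < l := by positivity
  have hlα : α * l = |B| + 1 := by rw [hl]; field_simp
  set p : Euc d →L[ℝ] ℝ := EuclideanSpace.proj i₀ with hp
  have hpx : ∀ x ∈ closure Ω, |p x| ≤ R := fun x hx => by
    have := PiLp.norm_apply_le x i₀
    exact this.trans (hR x hx)
  set e : Euc d → ℝ := fun x => Real.exp (l * p x) with he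
  set μ : ℝ := Real.exp (l * R) / l with hμ
  have hμpos : 0 < μ := by positivity
  have heC : ContDiff ℝ 2 e := by fun_prop
  have he1 : ∀ x, HasFDerivAt e ((l * e x) • p) x := fun x => by
    have h := ((p.hasFDerivAt (x := x)).const_mul l).exp
    rw [smul_smul, mul_comm] at h
    exact h
  have hfe : fderiv ℝ e = fun x => (l * e x) • p := funext fun x => (he1 x).fderiv
  have hffe : ∀ x ξ η, fderiv ℝ (fderiv ℝ e) x ξ η = l ^ 2 * e x * p ξ * p η := by
    intro x ξ η
    have h : HasFDerivAt (fun x => (l * e x) • p) ((l • ((l * e x) • p)).smulRight p) x :=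
      ((he1 x).const_mul l).smul_const p
    rw [hfe, h.fderiv]
    simp only [ContinuousLinearMap.smulRight_apply, smul_apply, smul_eq_mul]
    ring
  have hps : ∀ i, p (EuclideanSpace.single i 1) = if i = i₀ then 1 else 0 := by
    intro i
    simp [hp, eq_comm]
  have hLe : ∀ x, L.apply e x =
      - (L.a x i₀ i₀ * (l ^ 2 * e x)) + L.b x i₀ * (l * e x) + L.c x * e x := by
    intro x
    simp only [apply, iteratedFDeriv_two_apply, hffe]
    simp [hfe, hps]
  have heS : ContDiff ℝ 2 ((-μ) • e) := heC.const_smul (-μ)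
  refine ⟨(fun _ => μ * Real.exp (l * R)) + (-μ) • e, μ * Real.exp (l * R), by positivity,
    ContDiff.add (f := fun _ => μ * Real.exp (l * R)) contDiff_const heS, ?_, ?_⟩
  · intro x hx
    have h1 : e x ≤ Real.exp (l * R) :=
      Real.exp_le_exp.2 (mul_le_mul_of_nonneg_left (abs_le.1 (hpx x hx)).2 hlpos.le)
    have h2 : 0 < e x := Real.exp_pos _
    simp only [Pi.add_apply, Pi.smul_apply, smul_eq_mul]
    constructor <;> nlinarith
  · intro x hx
    rw [apply_add L contDiffAt_const heS.contDiffAt,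
      apply_const_smul L _ heC.contDiffAt, apply_const, hLe]
    obtain ⟨ha, hb, -⟩ := hB x hx
    have hxc := hpx x (subset_closure hx)
    have h1 : e x ≤ Real.exp (l * R) :=
      Real.exp_le_exp.2 (mul_le_mul_of_nonneg_left (abs_le.1 hxc).2 hlpos.le)
    have h2 : 0 < e x := Real.exp_pos _
    have h3 : 1 ≤ Real.exp (l * R) * e x := by
      rw [he, ← Real.exp_add]
      refine Real.one_le_exp ?_
      nlinarith [(abs_le.1 hxc).1]
    have haα : α ≤ L.a x i₀ i₀ := by
      simpa [Pi.single_apply] using hell x hx (Pi.single i₀ 1)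
    have hbB : L.b x i₀ ≤ |B| := (le_abs_self _).trans ((hb i₀).trans (le_abs_self B))
    have hcx := mul_nonneg (hc x hx) (mul_nonneg hμpos.le (sub_nonneg.2 h1))
    have h4 : l ≤ L.a x i₀ i₀ * l ^ 2 - L.b x i₀ * l := by
      have : |B| + 1 ≤ L.a x i₀ i₀ * l := hlα ▸ mul_le_mul_of_nonneg_right haα hlpos.le
      nlinarith
    have h5 : 1 ≤ μ * e x * (L.a x i₀ i₀ * l ^ 2 - L.b x i₀ * l) := by
      calc (1 : ℝ) ≤ Real.exp (l * R) * e x := h3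
        _ = μ * e x * l := by rw [hμ]; field_simp
        _ ≤ _ := mul_le_mul_of_nonneg_left h4 (by positivity)
    nlinarith

/-- A priori bound in the sup norm for the strong Dirichlet problem, by comparison of `± v` with
`m + (m + ε) ψ` for a barrier `ψ`. -/
theorem IsUniformlyElliptic.exists_abs_le_mul_max (hd : 0 < d) (hopen : IsOpen Ω)
    (hbdd : Bornology.IsBounded Ω) (hL : L.IsUniformlyElliptic Ω) (hc : ∀ x ∈ Ω, 0 ≤ L.c x) :
    ∃ C : ℝ, 0 ≤ C ∧ ∀ v : Euc d → ℝ, ContDiffOn ℝ 2 v Ω → ContinuousOn v (closure Ω) →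
      ∀ F G : ℝ, (∀ x ∈ Ω, |L.apply v x| ≤ F) → (∀ y ∈ frontier Ω, |v y| ≤ G) →
        ∀ x ∈ closure Ω, |v x| ≤ C * max F G := by
  obtain ⟨ψ, K, hK, hψ, hψb, hψL⟩ := exists_barrier hd hbdd hL hc
  refine ⟨1 + K, by positivity, fun v hv hvc F G hF hG x hx => ?_⟩
  obtain ⟨z, hz⟩ : Ω.Nonempty := closure_nonempty_iff.1 ⟨x, hx⟩
  set m := max F G
  have hm : 0 ≤ m := ((abs_nonneg _).trans (hF z hz)).trans (le_max_left _ _)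
  have hψS : ∀ r : ℝ, ContDiff ℝ 2 (r • ψ) := fun r => hψ.const_smul r
  have hψA : ∀ r : ℝ, ContDiff ℝ 2 ((fun _ => m) + r • ψ) := fun r =>
    ContDiff.add (f := fun _ => m) contDiff_const (hψS r)
  have hvS : ∀ r : ℝ, ContDiffOn ℝ 2 (r • v) Ω := fun r => hv.const_smul r
  -- `ε` makes the differential inequality strict
  have key : ∀ s : ℝ, |s| = 1 → ∀ ε > 0, 0 ≤ m + (m + ε) * ψ x - s * v x := by
    intro s hs ε hε
    have := nonneg_of_apply_pos hopen hbdd hL hc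
      (w := ((fun _ => m) + (m + ε) • ψ) + (-s) • v)
      (ContDiffOn.add (hψA _).contDiffOn (hvS _))
      ((hψA _).continuous.continuousOn.add (hvc.const_smul _)) ?_ ?_ x hx
    · simpa [sub_eq_add_neg] using this
    · intro y hy
      have hvy : ContDiffAt ℝ 2 v y := hv.contDiffAt (hopen.mem_nhds hy)
      rw [apply_add L (hψA _).contDiffAt ((hvS _).contDiffAt (hopen.mem_nhds hy)),
        apply_add L contDiffAt_const (hψS _).contDiffAt,
        apply_const_smul L _ hψ.contDiffAt, apply_const_smul L _ hvy, apply_const]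
      have h1 : s * L.apply v y ≤ m := by
        refine (le_abs_self _).trans ?_
        rw [abs_mul, hs, one_mul]
        exact (hF y hy).trans (le_max_left _ _)
      have h2 := mul_nonneg (hc y hy) hm
      nlinarith [hψL y hy]
    · intro y hy
      have h1 : s * v y ≤ m := by
        refine (le_abs_self _).trans ?_
        rw [abs_mul, hs, one_mul]
        exact (hG y hy).trans (le_max_right _ _)
      have h2 := (hψb y (frontier_subset_closure hy)).1
      simp only [Pi.add_apply, Pi.smul_apply, smul_eq_mul]
      nlinarith
  have key2 : ∀ s : ℝ, |s| = 1 → s * v x ≤ (1 + K) * m := by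
    intro s hs
    refine le_of_forall_pos_le_add fun ε hε => ?_
    have h := key s hs (ε / (1 + K)) (by positivity)
    have h2 := hψb x hx
    have h3 : ε / (1 + K) * ψ x ≤ ε := by
      rw [div_mul_eq_mul_div, div_le_iff₀ (by positivity)]
      nlinarith
    nlinarith
  refine abs_le.2 ⟨?_, ?_⟩
  · linarith [key2 (-1) (by simp)]
  · linarith [key2 1 (by simp)]

end SecondOrderOperator

/-! ### Extension by zero -/

section ExtendZero

variable {d : ℕ} {Ω : Set (Euc d)} {U : Type u} [NormedAddCommGroup U] [InnerProductSpace ℝ U]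
  [RKHS ℝ U (closure Ω) ℝ]

@[simp]
theorem extendZero_apply_coe (v : U) (x : closure Ω) : extendZero v (x : Euc d) = v x :=
  Subtype.val_injective.extend_apply _ _ _

theorem extendZero_apply_of_notMem (v : U) {x : Euc d} (hx : x ∉ closure Ω) :
    extendZero v x = 0 :=
  Function.extend_apply' _ _ _ fun ⟨a, ha⟩ => hx (ha ▸ a.2)

theorem extendZero_add (v w : U) : extendZero (v + w) = extendZero v + extendZero w := by
  ext x
  by_cases hx : x ∈ closure Ω
  · lift x to closure Ω using hx
    simp
  · simp [extendZero_apply_of_notMem _ hx]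

theorem extendZero_smul (r : ℝ) (v : U) : extendZero (r • v) = r • extendZero v := by
  ext x
  by_cases hx : x ∈ closure Ω
  · lift x to closure Ω using hx
    simp
  · simp [extendZero_apply_of_notMem _ hx]

theorem continuousOn_extendZero {v : U} (hv : Continuous (v : closure Ω → ℝ)) :
    ContinuousOn (extendZero v) (closure Ω) := by
  rw [continuousOn_iff_continuous_domRestrict]
  convert hv using 1
  ext x
  simp

end ExtendZero

/-! ### Collocation functionals and the data norm -/

section DataFunctionals

variable {d : ℕ} {L : SecondOrderOperator d} {Ω : Set (Euc d)} {U : Type u}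
  [NormedAddCommGroup U] [InnerProductSpace ℝ U] [RKHS ℝ U (closure Ω) ℝ]

theorem IsCollocationSpace.exists_interior_functional (hU : IsCollocationSpace L Ω U)
    (hopen : IsOpen Ω) {x : Euc d} (hx : x ∈ Ω) :
    ∃ t ∈ dataFunctionals L Ω U, ∀ v : U, t v = L.apply (extendZero v) x := by
  have hC : ∀ v : U, ContDiffAt ℝ 2 (extendZero v) x := fun v =>
    (hU.contDiffOn v).contDiffAt (hopen.mem_nhds hx)
  obtain ⟨k, hk⟩ := hU.interior_bounded
  refine ⟨LinearMap.mkContinuous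
    { toFun := fun v : U => L.apply (extendZero v) x
      map_add' := fun v w => by rw [extendZero_add, L.apply_add (hC v) (hC w)]
      map_smul' := fun r v => by rw [extendZero_smul, L.apply_const_smul r (hC v)]; rfl } k
    (fun v => hk v x hx), Or.inl ⟨x, hx, fun v => rfl⟩, fun v => rfl⟩

theorem exists_boundary_functional {y : Euc d} (hy : y ∈ frontier Ω) :
    ∃ t ∈ dataFunctionals L Ω U, ∀ v : U, t v = extendZero v y := by
  let z : closure Ω := ⟨y, frontier_subset_closure hy⟩
  have h : ∀ v : U, v z = extendZero v y := fun v => (extendZero_apply_coe v z).symm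
  refine ⟨(ContinuousLinearMap.proj z).comp (RKHS.coeCLM ℝ), Or.inr ⟨y, hy, h⟩, h⟩

theorem IsCollocationSpace.exists_abs_le (hU : IsCollocationSpace L Ω U) :
    ∃ k : ℝ, ∀ t ∈ dataFunctionals L Ω U, ∀ v : U, |t v| ≤ k * ‖v‖ := by
  obtain ⟨k₁, h₁⟩ := hU.interior_bounded
  obtain ⟨k₂, h₂⟩ := hU.boundary_bounded
  refine ⟨max k₁ k₂, ?_⟩
  rintro t (⟨x, hx, ht⟩ | ⟨y, hy, ht⟩) v
  · rw [ht]
    exact (h₁ v x hx).trans (mul_le_mul_of_nonneg_right (le_max_left _ _) (norm_nonneg _))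
  · rw [ht]
    exact (h₂ v y hy).trans (mul_le_mul_of_nonneg_right (le_max_right _ _) (norm_nonneg _))

theorem IsCollocationSpace.abs_le_dataNorm (hU : IsCollocationSpace L Ω U)
    {t : StrongDual ℝ U} (ht : t ∈ dataFunctionals L Ω U) (v : U) :
    |t v| ≤ dataNorm L Ω v := by
  obtain ⟨k, hk⟩ := hU.exists_abs_le
  refine le_ciSup (f := fun t : dataFunctionals L Ω U => |(t : StrongDual ℝ U) v|) ?_ ⟨t, ht⟩
  exact ⟨k * ‖v‖, by rintro _ ⟨s, rfl⟩; exact hk s s.2 v⟩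

theorem dataNorm_nonneg (v : U) : 0 ≤ dataNorm L Ω v :=
  Real.iSup_nonneg fun _ => abs_nonneg _

theorem dataNorm_sub_comm (v w : U) : dataNorm L Ω (v - w) = dataNorm L Ω (w - v) := by
  unfold dataNorm
  simp_rw [map_sub, abs_sub_comm]

theorem IsCollocationSpace.norm_restrictData_le (hU : IsCollocationSpace L Ω U) {N : ℕ}
    {t : Fin N → StrongDual ℝ U} (ht : ∀ k, t k ∈ dataFunctionals L Ω U) (v : U) :
    ‖restrictData t v‖ ≤ dataNorm L Ω v :=
  (pi_norm_le_iff_of_nonneg (dataNorm_nonneg v)).2 fun k => hU.abs_le_dataNorm (ht k) v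

/-- An a priori bound for the Dirichlet problem makes the sup norm a well-posedness norm on every
space of functions admitting the collocation functionals. -/
theorem IsCollocationSpace.isWellPosed_supSeminorm (hU : IsCollocationSpace L Ω U)
    (hopen : IsOpen Ω) (hB : ∀ v : U, BddAbove (range fun x : closure Ω => |v x|))
    {C : ℝ} (hC : 0 ≤ C)
    (h : ∀ v : Euc d → ℝ, ContDiffOn ℝ 2 v Ω → ContinuousOn v (closure Ω) →
      ∀ F G : ℝ, (∀ x ∈ Ω, |L.apply v x| ≤ F) → (∀ y ∈ frontier Ω, |v y| ≤ G) →
        ∀ x ∈ closure Ω, |v x| ≤ C * max F G) :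
    IsWellPosed L Ω (supSeminorm hB) C := by
  refine ⟨hC, fun v => Real.iSup_le (fun x => ?_) (mul_nonneg hC (dataNorm_nonneg v))⟩
  have := h (extendZero v) (hU.contDiffOn v) (continuousOn_extendZero (hU.continuous v))
    (dataNorm L Ω v) (dataNorm L Ω v) (fun x hx => ?_) (fun y hy => ?_) x x.2
  · simpa using this
  · obtain ⟨t, ht, htv⟩ := hU.exists_interior_functional hopen hx
    exact htv v ▸ hU.abs_le_dataNorm ht v
  · obtain ⟨t, ht, htv⟩ := exists_boundary_functional (L := L) (U := U) hy
    exact htv v ▸ hU.abs_le_dataNorm ht v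

theorem pointEvaluationsBounded_supSeminorm
    (hB : ∀ v : U, BddAbove (range fun x : closure Ω => |v x|)) :
    PointEvaluationsBounded (supSeminorm hB) 1 :=
  ⟨one_pos, fun v x => (le_ciSup (hB v) x).trans_eq (one_mul _).symm⟩

end DataFunctionals

/-! ### Finite norming sets -/

section Norming

variable {U : Type*} [NormedAddCommGroup U] [NormedSpace ℝ U]

open scoped lp in
/-- On a finite-dimensional subspace, finitely many members of a bounded set of functionals
recover the supremum over the whole set up to a factor `2`. The subspace is mapped into
`ℓ^∞(Λ)`, and the unit sphere of its image is covered by finitely many of the open sets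
`{f | 1 / 2 < |f t|}`, `t ∈ Λ`. -/
theorem Submodule.exists_finite_norming (V : Submodule ℝ U) [FiniteDimensional ℝ V]
    {Λ : Set (StrongDual ℝ U)} {k : ℝ} (hΛ : ∀ t ∈ Λ, ∀ v : U, |t v| ≤ k * ‖v‖) :
    ∃ (N : ℕ) (t : Fin N → StrongDual ℝ U), (∀ i, t i ∈ Λ) ∧
      ∀ v ∈ V, ⨆ s : Λ, |(s : StrongDual ℝ U) v| ≤ 2 * ‖fun i => t i v‖ := by
  let E : V →ₗ[ℝ] lp (fun _ : Λ => ℝ) ∞ :=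
    { toFun := fun v => ⟨fun t => (t : StrongDual ℝ U) v, memℓp_infty
        ⟨k * ‖(v : U)‖, by rintro _ ⟨t, rfl⟩; exact hΛ t t.2 v⟩⟩
      map_add' := fun v w => by ext t; exact map_add (t : StrongDual ℝ U) _ _
      map_smul' := fun r v => by ext t; exact map_smul (t : StrongDual ℝ U) _ _ }
  set Y := LinearMap.range E
  have : ProperSpace Y := FiniteDimensional.proper_real Y
  have hopen : ∀ t : Λ, IsOpen {f : Y | 1 / 2 < |(f : lp (fun _ : Λ => ℝ) ∞) t|} := by
    intro t
    refine isOpen_lt continuous_const (continuous_abs.comp ?_)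
    have : LipschitzWith 1 fun f : lp (fun _ : Λ => ℝ) ∞ => (f : Λ → ℝ) t :=
      LipschitzWith.of_dist_le_mul fun f g => by
        rw [NNReal.coe_one, one_mul, dist_eq_norm, dist_eq_norm]
        exact lp.norm_apply_le_norm (by simp) (f - g) t
    exact this.continuous.comp continuous_subtype_val
  obtain ⟨F, hF⟩ := (isCompact_sphere (0 : Y) 1).elim_finite_subcover _ hopen (by
    intro f hf
    rw [mem_sphere_zero_iff_norm] at hf
    have hf' : ‖(f : lp (fun _ : Λ => ℝ) ∞)‖ = 1 := hf
    rw [mem_iUnion]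
    by_contra! hcon
    have : ‖(f : lp (fun _ : Λ => ℝ) ∞)‖ ≤ 1 / 2 :=
      lp.norm_le_of_forall_le (by norm_num) fun t => not_lt.1 (hcon t)
    linarith)
  refine ⟨F.card, fun i => (F.equivFin.symm i : Λ), fun i => (F.equivFin.symm i : Λ).2, ?_⟩
  intro v hv
  set R : ℝ := ‖fun i : Fin F.card => ((F.equivFin.symm i : Λ) : StrongDual ℝ U) v‖
  have hR : ∀ t ∈ F, |(t : StrongDual ℝ U) v| ≤ R := by
    intro t ht
    have := norm_le_pi_norm (fun i : Fin F.card =>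
      ((F.equivFin.symm i : Λ) : StrongDual ℝ U) v) (F.equivFin ⟨t, ht⟩)
    simpa using this
  set y : Y := ⟨E ⟨v, hv⟩, LinearMap.mem_range_self _ _⟩
  have hy : ‖y‖ ≤ 2 * R := by
    by_cases h0 : ‖y‖ = 0
    · rw [h0]; positivity
    have hpos : 0 < ‖y‖ := lt_of_le_of_ne (norm_nonneg _) (Ne.symm h0)
    have hmem : ‖y‖⁻¹ • y ∈ sphere (0 : Y) 1 := by
      rw [mem_sphere_zero_iff_norm, norm_smul, norm_inv, norm_norm, inv_mul_cancel₀ h0]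
    obtain ⟨t, ht, hlt⟩ := mem_iUnion₂.1 (hF hmem)
    have hlt' : 1 / 2 < |‖y‖⁻¹ * (t : StrongDual ℝ U) v| := hlt
    rw [abs_mul, abs_inv, abs_norm, inv_mul_eq_div, lt_div_iff₀ hpos] at hlt'
    linarith [hR t ht]
  refine Real.iSup_le (fun t => le_trans ?_ hy) (by positivity)
  exact lp.norm_apply_le_norm (by simp) (E ⟨v, hv⟩) t

/-- The distance to the image of a finite-dimensional subspace is attained. -/
theorem Submodule.exists_norm_sub_le {F : Type*} [NormedAddCommGroup F] [NormedSpace ℝ F]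
    [ProperSpace F] (V : Submodule ℝ U) [FiniteDimensional ℝ V] (R : U →ₗ[ℝ] F) (u : U) :
    ∃ w ∈ V, ∀ v ∈ V, ‖R (u - w)‖ ≤ ‖R (u - v)‖ := by
  have hcl : IsClosed (V.map R : Set F) := (V.map R).closed_of_finiteDimensional
  obtain ⟨_, ⟨w, hw, rfl⟩, h⟩ := hcl.exists_infDist_eq_dist ⟨0, zero_mem _⟩ (R u)
  refine ⟨w, hw, fun v hv => ?_⟩
  rw [map_sub, map_sub, ← dist_eq_norm, ← dist_eq_norm, ← h]
  exact infDist_le_dist_of_mem (mem_image_of_mem _ hv)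

end Norming

/-! ### Nodal bases -/

section Nodal

variable {X : Type*} {U : Type u} [NormedAddCommGroup U] [InnerProductSpace ℝ U]
  [CompleteSpace U] [RKHS ℝ U X ℝ]

theorem inner_kernelTranslate (x : X) (v : U) : inner ℝ (kernelTranslate U x) v = v x := by
  simp [kernelTranslate]

instance finiteDimensional_trialSpace {M : ℕ} (x : Fin M → X) :
    FiniteDimensional ℝ (trialSpace U x) :=
  FiniteDimensional.span_of_finite ℝ (finite_range _)

/-- An element of the trial space vanishing at all nodes is orthogonal to the trial space. -/
theorem eq_zero_of_mem_trialSpace {M : ℕ} {x : Fin M → X} {v : U} (hv : v ∈ trialSpace U x)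
    (h : ∀ j, v (x j) = 0) : v = 0 := by
  have : ∀ w ∈ trialSpace U x, inner ℝ w v = 0 := by
    intro w hw
    induction hw using Submodule.span_induction with
    | mem w hw =>
      obtain ⟨j, rfl⟩ := hw
      rw [inner_kernelTranslate, h]
    | zero => simp
    | add a b _ _ ha hb => rw [inner_add_left, ha, hb, add_zero]
    | smul r a _ ha => rw [inner_smul_left, ha, mul_zero]
  exact inner_self_eq_zero.1 (this v hv)

theorem exists_isNodalBasis {M : ℕ} {x : Fin M → X}
    (hx : LinearIndependent ℝ fun j => kernelTranslate U (x j)) :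
    ∃ s : Fin M → U, IsNodalBasis x s := by
  let ev : trialSpace U x →ₗ[ℝ] (Fin M → ℝ) :=
    { toFun := fun v j => (v : U) (x j)
      map_add' := fun v w => by ext; simp
      map_smul' := fun r v => by ext; simp }
  have hinj : Function.Injective ev := by
    rw [injective_iff_map_eq_zero]
    exact fun v hv => Subtype.ext (eq_zero_of_mem_trialSpace v.2 fun j => congrFun hv j)
  have hdim : Module.finrank ℝ (trialSpace U x) = Module.finrank ℝ (Fin M → ℝ) := by
    rw [trialSpace, finrank_span_eq_card hx, Module.finrank_pi]
  let e := ev.linearEquivOfInjective hinj hdim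
  let b := (Pi.basisFun ℝ (Fin M)).map e.symm
  refine ⟨fun j => b j, ⟨?_, fun j k => ?_⟩⟩
  · have : (range fun j => (b j : U)) = (trialSpace U x).subtype '' range b := by
      rw [← range_comp]; rfl
    rw [this, Submodule.span_image, b.span_eq, Submodule.map_top, Submodule.range_subtype]
  · have : e (b j) k = (Pi.single j 1 : Fin M → ℝ) k := by simp [b]
    change e (b j) k = _
    rw [this, Pi.single_apply]
    simp only [eq_comm]

theorem IsNodalBasis.sum_smul_mem {M : ℕ} {x : Fin M → X} {s : Fin M → U}
    (hs : IsNodalBasis x s) (a : Fin M → ℝ) : ∑ j, a j • s j ∈ trialSpace U x := by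
  rw [← hs.span_eq]
  exact Submodule.sum_mem _ fun j _ =>
    Submodule.smul_mem _ _ (Submodule.subset_span (mem_range_self j))

theorem RKHS.sum_apply {ι : Type*} (I : Finset ι) (f : ι → U) (y : X) :
    (∑ i ∈ I, f i) y = ∑ i ∈ I, f i y := by
  simp only [← inner_kernelTranslate, inner_sum]

theorem IsNodalBasis.sum_smul_apply {M : ℕ} {x : Fin M → X} {s : Fin M → U}
    (hs : IsNodalBasis x s) (a : Fin M → ℝ) (k : Fin M) : (∑ j, a j • s j) (x k) = a k := by
  rw [RKHS.sum_apply]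
  simp [hs.lagrange]

end Nodal

/-! ### Admissibility of the Sobolev spaces -/

section SobolevAdmissible

/-- The derivative of a family of functions whose point evaluations are continuous functionals is
again a continuous functional, as a pointwise limit of difference quotients. -/
theorem exists_dual_eq_fderiv {E U : Type*} [NormedAddCommGroup E] [NormedSpace ℝ E]
    [NormedAddCommGroup U] [NormedSpace ℝ U] [CompleteSpace U] {φ : U → E → ℝ} {Ω : Set E}
    (hΩ : IsOpen Ω) (hφ : ∀ y ∈ Ω, ∃ t : StrongDual ℝ U, ∀ v, t v = φ v y) {x : E} (hx : x ∈ Ω)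
    (hd : ∀ v, DifferentiableAt ℝ (φ v) x) (ξ : E) :
    ∃ t : StrongDual ℝ U, ∀ v, t v = fderiv ℝ (φ v) x ξ := by
  classical
  choose! F hF using hφ
  -- for small `h` the point `x + h • ξ` lies in `Ω`; the values of `D h` for large `h` are junk
  let D : ℝ → StrongDual ℝ U := fun h => h⁻¹ • (F (x + h • ξ) - F x)
  have hlim : Filter.Tendsto (fun h v => D h v) (𝓝[≠] 0) (𝓝 fun v => fderiv ℝ (φ v) x ξ) := by
    rw [tendsto_pi_nhds]
    intro v
    refine ((hd v).hasFDerivAt.hasLineDerivAt ξ).tendsto_slope_zero.congr' ?_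
    have hc : ContinuousAt (fun h : ℝ => x + h • ξ) 0 := by fun_prop
    have : ∀ᶠ h : ℝ in 𝓝 0, x + h • ξ ∈ Ω :=
      hc.eventually_mem (by simpa using hΩ.mem_nhds hx)
    filter_upwards [nhdsWithin_le_nhds this] with h hh
    simp [D, hF _ hh, hF _ hx]
  exact ⟨continuousLinearMapOfTendsto D hlim, fun v => rfl⟩

variable {d : ℕ} {L : SecondOrderOperator d} {Ω : Set (Euc d)} {U : Type u}
  [NormedAddCommGroup U] [InnerProductSpace ℝ U] [RKHS ℝ U (closure Ω) ℝ]

theorem exists_dual_eq_extendZero (y : closure Ω) :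
    ∃ t : StrongDual ℝ U, ∀ v, t v = extendZero v (y : Euc d) :=
  ⟨(ContinuousLinearMap.proj y).comp (RKHS.coeCLM ℝ), fun v => (extendZero_apply_coe v y).symm⟩

variable [CompleteSpace U]

theorem exists_dual_eq_apply (hopen : IsOpen Ω)
    (hC : ∀ v : U, ContDiffOn ℝ 2 (extendZero v) Ω) {x : Euc d} (hx : x ∈ Ω) :
    ∃ t : StrongDual ℝ U, ∀ v, t v = L.apply (extendZero v) x := by
  have hCA : ∀ v : U, ∀ y ∈ Ω, ContDiffAt ℝ 2 (extendZero v) y := fun v y hy =>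
    (hC v).contDiffAt (hopen.mem_nhds hy)
  have h0 : ∀ y ∈ Ω, ∃ t : StrongDual ℝ U, ∀ v, t v = extendZero v y := fun y hy =>
    exists_dual_eq_extendZero ⟨y, subset_closure hy⟩
  have h1 : ∀ ξ, ∀ y ∈ Ω, ∃ t : StrongDual ℝ U, ∀ v, t v = fderiv ℝ (extendZero v) y ξ :=
    fun ξ y hy => exists_dual_eq_fderiv hopen h0 hy
      (fun v => (hCA v y hy).differentiableAt (by norm_num)) ξ
  have hdd : ∀ v : U, ∀ y ∈ Ω, DifferentiableAt ℝ (fderiv ℝ (extendZero v)) y := fun v y hy =>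
    ((hCA v y hy).fderiv_right (m := 1) (by norm_num)).differentiableAt (by norm_num)
  have h2 : ∀ ξ η, ∃ t : StrongDual ℝ U, ∀ v,
      t v = fderiv ℝ (fderiv ℝ (extendZero v)) x ξ η := by
    intro ξ η
    obtain ⟨t, ht⟩ := exists_dual_eq_fderiv hopen (h1 η) hx
      (fun v => (hdd v x hx).clm_apply (differentiableAt_const η)) ξ
    refine ⟨t, fun v => ?_⟩
    rw [ht, fderiv_clm_apply (hdd v x hx) (differentiableAt_const η)]
    simp
  obtain ⟨t₀, ht₀⟩ := h0 x hx
  choose t₁ ht₁ using fun ξ => h1 ξ x hx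
  choose t₂ ht₂ using h2
  refine ⟨-(∑ i, ∑ j, L.a x i j • t₂ (EuclideanSpace.single i 1) (EuclideanSpace.single j 1))
    + (∑ i, L.b x i • t₁ (EuclideanSpace.single i 1)) + L.c x • t₀, fun v => ?_⟩
  simp [SecondOrderOperator.apply, iteratedFDeriv_two_apply, ht₀, ht₁, ht₂]

/-- A Hilbert space of restrictions of `C²` functions on `ℝ^d` with continuous point evaluations
admits uniformly bounded collocation functionals: by Banach–Steinhaus it is enough that they are
continuous and pointwise bounded. -/
theorem isCollocationSpace_of_forall_exists_contDiff (hopen : IsOpen Ω)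
    (hbdd : Bornology.IsBounded Ω) (hL : L.IsUniformlyElliptic Ω)
    (h : ∀ v : U, ∃ V : Euc d → ℝ, ContDiff ℝ 2 V ∧ ∀ x : closure Ω, v x = V x) :
    IsCollocationSpace L Ω U := by
  choose V hV hvV using h
  have hEq : ∀ v : U, EqOn (extendZero v) (V v) (closure Ω) := fun v x hx => by
    have := hvV v ⟨x, hx⟩
    rwa [← extendZero_apply_coe] at this
  have hC : ∀ v : U, ContDiffOn ℝ 2 (extendZero v) Ω := fun v =>
    (hV v).contDiffOn.congr fun x hx => hEq v (subset_closure hx)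
  have hb : ∀ v : U, ∃ S : ℝ, ∀ x ∈ closure Ω, ∀ k ≤ 2, ‖iteratedFDeriv ℝ k (V v) x‖ ≤ S := by
    intro v
    have : ∀ k : ℕ, k ≤ 2 → ∃ S : ℝ, ∀ x ∈ closure Ω, ‖iteratedFDeriv ℝ k (V v) x‖ ≤ S :=
      fun k hk => hbdd.isCompact_closure.exists_bound_of_continuousOn
        ((hV v).continuous_iteratedFDeriv (by exact_mod_cast hk)).continuousOn
    choose! S hS using this
    refine ⟨max (S 0) (max (S 1) (S 2)), fun x hx k hk => (hS k hk x hx).trans ?_⟩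
    interval_cases k <;> simp
  obtain ⟨κ, -, hκ⟩ := hL.exists_abs_apply_le
  have hcont : ∀ v : U, Continuous (v : closure Ω → ℝ) := fun v => by
    rw [show (v : closure Ω → ℝ) = fun x : closure Ω => V v x from funext (hvV v)]
    exact (hV v).continuous.comp continuous_subtype_val
  refine ⟨hC, hcont, ?_, ?_⟩
  · choose t ht using fun x : Ω => exists_dual_eq_apply (L := L) hopen hC x.2
    obtain ⟨k, hk⟩ := banach_steinhaus (g := t) fun v => by
      obtain ⟨S, hS⟩ := hb v
      refine ⟨κ * S, fun x => ?_⟩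
      rw [ht, Real.norm_eq_abs]
      refine hκ _ S x x.2 fun k hk => ?_
      have : extendZero v =ᶠ[𝓝 (x : Euc d)] V v := by
        filter_upwards [hopen.mem_nhds x.2] with y hy using hEq v (subset_closure hy)
      rw [(this.iteratedFDeriv ℝ k).eq_of_nhds]
      exact hS x (subset_closure x.2) k hk
    refine ⟨k, fun v x hx => ?_⟩
    rw [← ht ⟨x, hx⟩, ← Real.norm_eq_abs]
    exact (t ⟨x, hx⟩).le_of_opNorm_le (hk _) v
  · choose t ht using fun y : frontier Ω =>
      exists_dual_eq_extendZero (U := U) (⟨y, frontier_subset_closure y.2⟩ : closure Ω)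
    obtain ⟨k, hk⟩ := banach_steinhaus (g := t) fun v => by
      obtain ⟨S, hS⟩ := hb v
      refine ⟨S, fun y => ?_⟩
      rw [ht, hEq v (frontier_subset_closure y.2)]
      simpa using hS y (frontier_subset_closure y.2) 0 (by norm_num)
    refine ⟨k, fun v y hy => ?_⟩
    rw [← ht ⟨y, hy⟩, ← Real.norm_eq_abs]
    exact (t ⟨y, hy⟩).le_of_opNorm_le (hk _) v

/-- Kernel translates at distinct nodes are linearly independent as soon as the space contains
the smooth compactly supported functions, which separate the nodes. -/
theorem linearIndependent_kernelTranslate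
    (h : ∀ V : Euc d → ℝ, ContDiff ℝ (⊤ : ℕ∞) V → HasCompactSupport V →
      ∃ v : U, ∀ x : closure Ω, v x = V x)
    {M : ℕ} {x : Fin M → closure Ω} (hx : Function.Injective x) :
    LinearIndependent ℝ fun j => kernelTranslate U (x j) := by
  rw [Fintype.linearIndependent_iff]
  intro c hc i
  have hs : ((fun j => (x j : Euc d)) '' {j | j ≠ i})ᶜ ∈ 𝓝 (x i : Euc d) := by
    refine ((toFinite _).image _).isClosed.isOpen_compl.mem_nhds ?_
    rintro ⟨j, hj, hji⟩
    exact hj (hx (Subtype.ext hji))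
  obtain ⟨V, hVs, hVc, hV, -, hVi⟩ := exists_contDiff_tsupport_subset (n := (⊤ : ℕ∞)) hs
  obtain ⟨v, hv⟩ := h V hV hVc
  have hVj : ∀ j, j ≠ i → V (x j) = 0 := fun j hj => by
    by_contra h0
    exact hVs (subset_tsupport _ h0) ⟨j, hj, rfl⟩
  have h1 : ∑ j, c j * v (x j) = 0 := by
    have := congrArg (fun w : U => inner ℝ w v) hc
    simpa only [sum_inner, inner_smul_left, inner_kernelTranslate, inner_zero_left,
      RCLike.conj_to_real] using this
  rw [Finset.sum_eq_single i (fun j _ hj => by rw [hv, hVj j hj, mul_zero]) (by simp), hv, hVi,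
    mul_one] at h1
  exact h1

end SobolevAdmissible

/-! ### Functions with many zeros and bounded second derivatives -/

section SecondDerivativeBounds

/-- A function varies along a Lipschitz curve by at most the length of the curve times the bound
for its derivative. -/
theorem norm_image_sub_le_of_lipschitz_curve {E F : Type*} [NormedAddCommGroup E]
    [NormedSpace ℝ E] [NormedAddCommGroup F] [NormedSpace ℝ F] {Ω : Set E} (hΩ : IsOpen Ω)
    {f : E → F} (hf : ∀ y ∈ Ω, DifferentiableAt ℝ f y) {S : ℝ}
    (hS : ∀ y ∈ Ω, ‖fderiv ℝ f y‖ ≤ S) {g : ℝ → E} {l : ℝ≥0}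
    (hg : LipschitzOnWith l g (Icc 0 1)) (hgΩ : ∀ r ∈ Icc (0 : ℝ) 1, g r ∈ Ω) :
    ‖f (g 1) - f (g 0)‖ ≤ S * l := by
  have hS0 : 0 ≤ S := (norm_nonneg _).trans (hS (g 0) (hgΩ 0 (by simp)))
  have hcont : ContinuousOn (fun t => f (g t)) (Icc 0 1) := fun t ht =>
    ((hf _ (hgΩ t ht)).continuousAt).comp_continuousWithinAt (hg.continuousOn t ht)
  let s : Set ℝ := {t | ‖f (g t) - f (g 0)‖ ≤ S * l * t}
  suffices Icc (0 : ℝ) 1 ⊆ s by simpa [s] using this (show (1 : ℝ) ∈ Icc (0 : ℝ) 1 by simp)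
  refine IsClosed.Icc_subset_of_forall_mem_nhdsWithin ?_ (by simp [s]) ?_
  · rw [inter_comm]
    exact isClosed_Icc.isClosed_le (hcont.sub continuousOn_const).norm (by fun_prop)
  · rintro t ⟨hts, ht0, ht1⟩
    have htI : t ∈ Icc (0 : ℝ) 1 := ⟨ht0, ht1.le⟩
    obtain ⟨ρ, hρ, hball⟩ := Metric.isOpen_iff.1 hΩ _ (hgΩ t htI)
    have h1 : ∀ᶠ t' in 𝓝[>] t, g t' ∈ ball (g t) ρ := by
      have := (hg.continuousOn t htI).eventually_mem (ball_mem_nhds _ hρ)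
      refine Filter.Eventually.filter_mono ?_ this
      rw [← nhdsWithin_Ioc_eq_nhdsGT ht1]
      exact nhdsWithin_mono _ fun y hy => ⟨ht0.trans hy.1.le, hy.2⟩
    filter_upwards [h1, Ioc_mem_nhdsGT ht1] with t' hb ht'
    have ht'I : t' ∈ Icc (0 : ℝ) 1 := ⟨ht0.trans ht'.1.le, ht'.2⟩
    have h2 := (convex_ball (g t) ρ).norm_image_sub_le_of_norm_fderiv_le (𝕜 := ℝ)
      (fun y hy => hf y (hball hy)) (fun y hy => hS y (hball hy)) (mem_ball_self hρ) hb
    have h3 := hg.dist_le_mul t' ht'I t htI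
    rw [dist_eq_norm, dist_eq_norm, Real.norm_of_nonneg (by linarith [ht'.1])] at h3
    have hts' : ‖f (g t) - f (g 0)‖ ≤ S * l * t := hts
    change ‖f (g t') - f (g 0)‖ ≤ S * l * t'
    calc ‖f (g t') - f (g 0)‖ ≤ ‖f (g t') - f (g t)‖ + ‖f (g t) - f (g 0)‖ :=
          norm_sub_le_norm_sub_add_norm_sub _ _ _
      _ ≤ S * (l * (t' - t)) + S * l * t :=
          add_le_add (h2.trans (mul_le_mul_of_nonneg_left h3 hS0)) hts'
      _ = S * l * t' := by ring

theorem norm_le_sum_abs_apply_single {d : ℕ} (D : Euc d →L[ℝ] ℝ) :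
    ‖D‖ ≤ ∑ i, |D (EuclideanSpace.single i 1)| := by
  refine D.opNorm_le_bound (Finset.sum_nonneg fun i _ => abs_nonneg _) fun x => ?_
  have hx : x = ∑ i, x i • (EuclideanSpace.single i 1 : Euc d) := by
    ext j
    simp [Pi.single_apply]
  calc ‖D x‖ = |∑ i, x i * D (EuclideanSpace.single i 1)| := by
        conv_lhs => rw [hx]
        simp
    _ ≤ ∑ i, |x i * D (EuclideanSpace.single i 1)| := Finset.abs_sum_le_sum_abs _ _
    _ ≤ ∑ i, |D (EuclideanSpace.single i 1)| * ‖x‖ := by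
        refine Finset.sum_le_sum fun i _ => ?_
        rw [abs_mul, mul_comm]
        exact mul_le_mul_of_nonneg_left (PiLp.norm_apply_le x i) (abs_nonneg _)
    _ = _ := by rw [Finset.sum_mul]

/-- If `v` vanishes close to the centre `z` of a ball and close to the points `z + (r / 2) e_i`,
its value and its gradient at `z` are controlled by its second derivatives. -/
theorem abs_le_and_norm_fderiv_le_of_zeros {d : ℕ} (hd : 0 < d) {v : Euc d → ℝ} {z : Euc d}
    {r S : ℝ} (hr : 0 < r) (hv : ContDiffOn ℝ 2 v (ball z r))
    (hS : ∀ y ∈ ball z r, ‖fderiv ℝ (fderiv ℝ v) y‖ ≤ S)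
    (hzero : ∀ y ∈ ball z r, ∃ p, dist y p ≤ r / (8 * d) ∧ (p ∈ ball z r → v p = 0)) :
    |v z| ≤ 2 * r ^ 2 * S ∧ ‖fderiv ℝ v z‖ ≤ 8 * d * r * S := by
  have hzr : z ∈ ball z r := mem_ball_self hr
  have hd1 : (1 : ℝ) ≤ d := by exact_mod_cast hd
  have hS0 : 0 ≤ S := (norm_nonneg (fderiv ℝ (fderiv ℝ v) z)).trans (hS z hzr)
  have hCA : ∀ y ∈ ball z r, ContDiffAt ℝ 2 v y := fun y hy =>
    hv.contDiffAt (isOpen_ball.mem_nhds hy)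
  have hlip : ∀ y ∈ ball z r, ‖fderiv ℝ v y - fderiv ℝ v z‖ ≤ S * r := by
    intro y hy
    have := (convex_ball z r).norm_image_sub_le_of_norm_fderiv_le (𝕜 := ℝ) (f := fderiv ℝ v)
      (fun y hy => ((hCA y hy).fderiv_right (m := 1) (by norm_num)).differentiableAt
        (by norm_num)) hS hzr hy
    refine this.trans (mul_le_mul_of_nonneg_left ?_ hS0)
    rw [← dist_eq_norm]
    exact (mem_ball.1 hy).le
  set D := fderiv ℝ v z with hD
  have htaylor : ∀ p ∈ ball z r, v p = 0 → |v z + D (p - z)| ≤ r ^ 2 * S := by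
    intro p hp hp0
    have := (convex_ball z r).norm_image_sub_le_of_norm_fderiv_le' (𝕜 := ℝ) (f := v) (φ := D)
      (fun y hy => (hCA y hy).differentiableAt (by norm_num)) hlip hzr hp
    rw [hp0, Real.norm_eq_abs, show (0 : ℝ) - v z - D (p - z) = -(v z + D (p - z)) by ring,
      abs_neg] at this
    have h2 : ‖p - z‖ ≤ r := by rw [← dist_eq_norm]; exact (mem_ball.1 hp).le
    have : S * r * ‖p - z‖ ≤ S * r * r := mul_le_mul_of_nonneg_left h2 (by positivity)
    nlinarith
  set δ := r / (8 * d) with hδ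
  have hδr : δ ≤ r / 8 := by
    rw [hδ]
    exact div_le_div_of_nonneg_left hr.le (by norm_num) (by linarith)
  have hδd : d * δ = r / 8 := by rw [hδ]; field_simp
  have hδ0 : 0 < δ := by rw [hδ]; positivity
  obtain ⟨p₀, hp₀, hv₀⟩ := hzero z hzr
  have hp₀b : p₀ ∈ ball z r := by rw [mem_ball, dist_comm]; linarith
  have t₀ := htaylor p₀ hp₀b (hv₀ hp₀b)
  have hp₀n : ‖p₀ - z‖ ≤ δ := by rw [← dist_eq_norm, dist_comm]; exact hp₀
  -- the zeros near `z` and `z + (r / 2) e_i` differ by `(r / 2) e_i` up to an error `2 δ`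
  have hdir : ∀ i : Fin d, r / 2 * |D (EuclideanSpace.single i 1)| ≤
      2 * r ^ 2 * S + 2 * δ * ‖D‖ := by
    intro i
    set e : Euc d := EuclideanSpace.single i 1 with he
    have hen : ‖(r / 2) • e‖ = r / 2 := by
      rw [norm_smul, he]
      simp [abs_of_pos hr]
    have hq : z + (r / 2) • e ∈ ball z r := by
      rw [mem_ball, dist_eq_norm, add_sub_cancel_left, hen]
      linarith
    obtain ⟨p, hp, hvp⟩ := hzero _ hq
    have hpn : ‖p - (z + (r / 2) • e)‖ ≤ δ := by rw [← dist_eq_norm, dist_comm]; exact hp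
    have hpb : p ∈ ball z r := by
      rw [mem_ball]
      have h1 := dist_triangle p (z + (r / 2) • e) z
      rw [dist_comm p (z + _), dist_self_add_left, hen] at h1
      linarith
    have t := htaylor p hpb (hvp hpb)
    have hdec : (r / 2) * D e = (v z + D (p - z)) - (v z + D (p₀ - z))
        - D (p - (z + (r / 2) • e)) + D (p₀ - z) := by
      simp only [map_sub, map_add, map_smul, smul_eq_mul]
      ring
    have b1 : |D (p - (z + (r / 2) • e))| ≤ ‖D‖ * δ :=
      (D.le_opNorm _).trans (mul_le_mul_of_nonneg_left hpn (norm_nonneg _))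
    have b2 : |D (p₀ - z)| ≤ ‖D‖ * δ :=
      (D.le_opNorm _).trans (mul_le_mul_of_nonneg_left hp₀n (norm_nonneg _))
    have : r / 2 * |D e| = |r / 2 * D e| := by
      rw [abs_mul, abs_of_pos (by positivity : 0 < r / 2)]
    rw [this, hdec, abs_le]
    rw [abs_le] at t t₀ b1 b2
    constructor <;> linarith
  -- the choice of `δ` makes the summed perturbations `2 d δ ‖D‖` at most half of `(r / 2) ‖D‖`
  have hDn : ‖D‖ ≤ 8 * d * r * S := by
    have h1 : r / 2 * ‖D‖ ≤ d * (2 * r ^ 2 * S + 2 * δ * ‖D‖) := by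
      calc r / 2 * ‖D‖ ≤ r / 2 * ∑ i, |D (EuclideanSpace.single i 1)| :=
            mul_le_mul_of_nonneg_left (norm_le_sum_abs_apply_single D) (by positivity)
        _ = ∑ i, r / 2 * |D (EuclideanSpace.single i 1)| := Finset.mul_sum _ _ _
        _ ≤ ∑ _i : Fin d, (2 * r ^ 2 * S + 2 * δ * ‖D‖) := Finset.sum_le_sum fun i _ => hdir i
        _ = _ := by rw [Finset.sum_const, Finset.card_univ, Fintype.card_fin, nsmul_eq_mul]
    have h2 : d * (2 * r ^ 2 * S + 2 * δ * ‖D‖) = r * (2 * d * r * S) + r / 4 * ‖D‖ := by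
      have : d * (2 * δ * ‖D‖) = 2 * (d * δ) * ‖D‖ := by ring
      rw [mul_add, this, hδd]
      ring
    have h3 : r * ‖D‖ ≤ r * (8 * d * r * S) := by linarith
    exact le_of_mul_le_mul_left h3 hr
  refine ⟨?_, hDn⟩
  have b2 : |D (p₀ - z)| ≤ r ^ 2 * S :=
    calc |D (p₀ - z)| ≤ ‖D‖ * ‖p₀ - z‖ := D.le_opNorm _
      _ ≤ 8 * d * r * S * δ := mul_le_mul hDn hp₀n (norm_nonneg _) (by positivity)
      _ = 8 * (d * δ) * (r * S) := by ring
      _ = r ^ 2 * S := by rw [hδd]; ring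
  rw [abs_le] at *
  constructor <;> linarith

/-- On a domain of finite inner diameter, a function vanishing at sufficiently dense nodes is
controlled together with its gradient by its second derivatives: this holds at the centre of one
fixed ball and propagates along curves. -/
theorem HasFiniteInnerDiameter.exists_norm_iteratedFDeriv_le {d : ℕ} (hd : 0 < d)
    {Ω : Set (Euc d)} (hopen : IsOpen Ω) (hΩ : HasFiniteInnerDiameter Ω) :
    ∃ κ δ : ℝ, 0 < δ ∧ ∀ (M : ℕ) (x : Fin M → closure Ω), FillDistanceLE Ω x δ →
      ∀ v : Euc d → ℝ, ContDiffOn ℝ 2 v Ω → (∀ j, v (x j) = 0) →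
      ∀ S : ℝ, (∀ y ∈ Ω, ‖iteratedFDeriv ℝ 2 v y‖ ≤ S) →
        ∀ y ∈ Ω, ∀ k ≤ 2, ‖iteratedFDeriv ℝ k v y‖ ≤ κ * S := by
  rcases Ω.eq_empty_or_nonempty with rfl | ⟨z, hz⟩
  · exact ⟨0, 1, one_pos, fun M x _ v _ _ S _ y hy => absurd hy (notMem_empty y)⟩
  obtain ⟨l, hl⟩ := hΩ
  obtain ⟨r, hr, hball⟩ := Metric.isOpen_iff.1 hopen z hz
  set G : ℝ := 8 * d * r + l
  have hG : 0 ≤ G := by positivity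
  refine ⟨1 + G + (2 * r ^ 2 + G * l), r / (8 * d), by positivity, ?_⟩
  intro M x hx v hv hvx S hS
  have hS0 : 0 ≤ S := (norm_nonneg _).trans (hS z hz)
  have hCA : ∀ y ∈ Ω, ContDiffAt ℝ 2 v y := fun y hy => hv.contDiffAt (hopen.mem_nhds hy)
  have hS' : ∀ y ∈ Ω, ‖fderiv ℝ (fderiv ℝ v) y‖ ≤ S := fun y hy => by
    rw [← norm_iteratedFDeriv_one, norm_iteratedFDeriv_fderiv]
    exact hS y hy
  obtain ⟨hvz, hDz⟩ := abs_le_and_norm_fderiv_le_of_zeros hd hr (hv.mono hball)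
    (fun y hy => hS' y (hball hy)) fun y hy => by
      obtain ⟨j, hj⟩ := hx y (hball hy)
      exact ⟨x j, hj, fun _ => hvx j⟩
  have hD : ∀ y ∈ Ω, ‖fderiv ℝ v y‖ ≤ G * S := by
    intro y hy
    obtain ⟨g, hg, hg0, hg1, hgΩ⟩ := hl z hz y hy
    have := norm_image_sub_le_of_lipschitz_curve hopen (f := fderiv ℝ v)
      (fun y hy => ((hCA y hy).fderiv_right (m := 1) (by norm_num)).differentiableAt
        (by norm_num)) hS' hg hgΩ
    rw [hg0, hg1] at this
    have h2 := norm_le_norm_add_norm_sub (fderiv ℝ v z) (fderiv ℝ v y)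
    rw [norm_sub_rev] at this
    have : G * S = 8 * d * r * S + S * l := by ring
    linarith
  have hv0 : ∀ y ∈ Ω, ‖v y‖ ≤ (2 * r ^ 2 + G * l) * S := by
    intro y hy
    obtain ⟨g, hg, hg0, hg1, hgΩ⟩ := hl z hz y hy
    have := norm_image_sub_le_of_lipschitz_curve hopen (f := v)
      (fun y hy => (hCA y hy).differentiableAt (by norm_num)) hD hg hgΩ
    rw [hg0, hg1] at this
    have h2 := norm_le_norm_add_norm_sub (v z) (v y)
    rw [norm_sub_rev] at this
    rw [Real.norm_eq_abs (v z)] at h2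
    have : (2 * r ^ 2 + G * l) * S = 2 * r ^ 2 * S + G * S * l := by ring
    linarith
  intro y hy k hk
  have e1 : 0 ≤ G * S := by positivity
  have e2 : 0 ≤ (2 * r ^ 2 + G * l) * S := by positivity
  interval_cases k
  · rw [norm_iteratedFDeriv_zero]
    linarith [hv0 y hy]
  · rw [norm_iteratedFDeriv_one]
    linarith [hD y hy]
  · linarith [hS y hy]

end SecondDerivativeBounds

/-! ### Stability and error estimates on trial spaces -/

section Collocation

variable {d : ℕ} {L : SecondOrderOperator d} {Ω : Set (Euc d)} {U : Type u}
  [NormedAddCommGroup U] [InnerProductSpace ℝ U] [RKHS ℝ U (closure Ω) ℝ]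

/-- The data norm is controlled by the derivatives of order at most two inside `Ω`; the boundary
values are reached by continuity. -/
theorem IsCollocationSpace.dataNorm_le (hU : IsCollocationSpace L Ω U) {κ : ℝ} (hκ : 1 ≤ κ)
    (hκL : ∀ (v : Euc d → ℝ) (S : ℝ), ∀ x ∈ Ω,
      (∀ k ≤ 2, ‖iteratedFDeriv ℝ k v x‖ ≤ S) → |L.apply v x| ≤ κ * S)
    {v : U} {S : ℝ} (hS0 : 0 ≤ S)
    (hS : ∀ y ∈ Ω, ∀ k ≤ 2, ‖iteratedFDeriv ℝ k (extendZero v) y‖ ≤ S) :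
    dataNorm L Ω v ≤ κ * S := by
  refine Real.iSup_le ?_ (by positivity)
  rintro ⟨t, ⟨x, hx, ht⟩ | ⟨y, hy, ht⟩⟩
  · change |t v| ≤ _
    rw [ht]
    exact hκL _ S x hx (hS x hx)
  · change |t v| ≤ _
    rw [ht]
    have : |extendZero v y| ≤ S := by
      refine le_on_closure (s := Ω) (f := fun y => |extendZero v y|) (g := fun _ => S)
        (fun y hy => ?_) (continuousOn_extendZero (hU.continuous v)).abs continuousOn_const
        (frontier_subset_closure hy)
      simpa using hS y hy 0 (by norm_num)
    nlinarith

theorem restrictData_sub {N : ℕ} (t : Fin N → StrongDual ℝ U) (v w : U) :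
    restrictData t (v - w) = restrictData t v - restrictData t w := by
  ext k
  simp [restrictData]

theorem stiffnessMatrix_mulVec {N M : ℕ} (t : Fin N → StrongDual ℝ U) (s : Fin M → U)
    (a : Fin M → ℝ) : stiffnessMatrix t s *ᵥ a = restrictData t (∑ j, a j • s j) := by
  ext k
  simp [stiffnessMatrix, restrictData, Matrix.mulVec, dotProduct, mul_comm]

/-- Test functionals norming the trial space, on which every residual has a best
approximation. -/
theorem IsCollocationSpace.exists_testFunctionals (hU : IsCollocationSpace L Ω U)
    (V : Submodule ℝ U) [FiniteDimensional ℝ V] :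
    ∃ (N : ℕ) (t : Fin N → StrongDual ℝ U),
      (∀ k, t k ∈ dataFunctionals L Ω U) ∧
      (∀ v ∈ V, dataNorm L Ω v ≤ 2 * ‖restrictData t v‖) ∧
      ∀ u : U, ∃ w ∈ V, ∀ v ∈ V, ‖restrictData t (u - w)‖ ≤ ‖restrictData t (u - v)‖ := by
  obtain ⟨k, hk⟩ := hU.exists_abs_le
  obtain ⟨N, t, ht, hnorm⟩ := V.exists_finite_norming hk
  exact ⟨N, t, ht, hnorm, fun u =>
    V.exists_norm_sub_le (LinearMap.pi fun i => (t i : U →ₗ[ℝ] ℝ)) u⟩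

section Stability

variable {V : Submodule ℝ U} {N : ℕ} {t : Fin N → StrongDual ℝ U} {p : Seminorm ℝ U} {C γ : ℝ}

/-- Stability on the trial space: norming test functionals turn well-posedness into a discrete
inf-sup bound. -/
theorem IsWellPosed.le_norm_restrictData (hp : IsWellPosed L Ω p C)
    (ht : ∀ v ∈ V, dataNorm L Ω v ≤ 2 * ‖restrictData t v‖) {v : U} (hv : v ∈ V) :
    p v ≤ 2 * C * ‖restrictData t v‖ := by
  have := mul_le_mul_of_nonneg_left (ht v hv) hp.1
  linarith [hp.2 v]

theorem IsWellPosed.error_le (hp : IsWellPosed L Ω p C) (hU : IsCollocationSpace L Ω U)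
    (htΛ : ∀ k, t k ∈ dataFunctionals L Ω U)
    (ht : ∀ v ∈ V, dataNorm L Ω v ≤ 2 * ‖restrictData t v‖) {u v w : U} {CA : ℝ}
    (hCA : 0 ≤ CA) (hv : v ∈ V) (hw : w ∈ V)
    (hres : ‖restrictData t (u - w)‖ ≤ CA * ‖restrictData t (u - v)‖) :
    p (u - w) ≤ C * (2 * CA + 3) * dataNorm L Ω (v - u) := by
  have hC := hp.1
  have h1 : p (u - w) ≤ p (u - v) + p (v - w) := by
    simpa using map_add_le_add p (u - v) (v - w)
  have h2 : p (v - w) ≤ 2 * C * ‖restrictData t (v - w)‖ :=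
    hp.le_norm_restrictData ht (V.sub_mem hv hw)
  have h3 : ‖restrictData t (v - w)‖ ≤ ‖restrictData t (u - w)‖ + ‖restrictData t (u - v)‖ := by
    rw [show v - w = (u - w) - (u - v) by abel, restrictData_sub]
    exact norm_sub_le _ _
  have h4 : ‖restrictData t (u - v)‖ ≤ dataNorm L Ω (v - u) := by
    rw [dataNorm_sub_comm]
    exact hU.norm_restrictData_le htΛ _
  have h5 := hp.2 (u - v)
  rw [dataNorm_sub_comm] at h5
  calc p (u - w) ≤ C * dataNorm L Ω (v - u)
        + 2 * C * (CA * ‖restrictData t (u - v)‖ + ‖restrictData t (u - v)‖) := by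
        have := mul_le_mul_of_nonneg_left (h3.trans (add_le_add_left hres _))
          (by positivity : 0 ≤ 2 * C)
        linarith
    _ ≤ C * dataNorm L Ω (v - u)
        + 2 * C * (CA * dataNorm L Ω (v - u) + dataNorm L Ω (v - u)) := by gcongr
    _ = _ := by ring

/-- Error at a point where the competitor `v` agrees with `u`, as an interpolant does at the
nodes. -/
theorem IsWellPosed.abs_sub_le_of_eq (hp : IsWellPosed L Ω p C)
    (hγ : PointEvaluationsBounded p γ)
    (ht : ∀ v ∈ V, dataNorm L Ω v ≤ 2 * ‖restrictData t v‖) {u v w : U} {CA : ℝ}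
    (hv : v ∈ V) (hw : w ∈ V)
    (hres : ‖restrictData t (u - w)‖ ≤ CA * ‖restrictData t (u - v)‖)
    {y : closure Ω} (hy : v y = u y) :
    |u y - w y| ≤ 2 * γ * C * (1 + CA) * ‖restrictData t (u - v)‖ := by
  have hC := hp.1
  have hγ0 := hγ.1
  have h1 : |u y - w y| ≤ γ * p (v - w) := by
    have := hγ.2 (v - w) y
    rwa [RKHS.coe_sub, Pi.sub_apply, hy] at this
  have h2 : p (v - w) ≤ 2 * C * ‖restrictData t (v - w)‖ :=
    hp.le_norm_restrictData ht (V.sub_mem hv hw)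
  have h3 : ‖restrictData t (v - w)‖ ≤ ‖restrictData t (u - w)‖ + ‖restrictData t (u - v)‖ := by
    rw [show v - w = (u - w) - (u - v) by abel, restrictData_sub]
    exact norm_sub_le _ _
  calc |u y - w y| ≤ γ * (2 * C *
        (CA * ‖restrictData t (u - v)‖ + ‖restrictData t (u - v)‖)) := by
        refine h1.trans (mul_le_mul_of_nonneg_left (h2.trans ?_) hγ0.le)
        exact mul_le_mul_of_nonneg_left (h3.trans (add_le_add_left hres _)) (by positivity)
    _ = _ := by ring

/-- Stability of the stiffness matrix: the coefficients in a nodal basis are nodal values. -/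
theorem IsWellPosed.norm_le_stiffnessMatrix [CompleteSpace U] (hp : IsWellPosed L Ω p C)
    (hγ : PointEvaluationsBounded p γ) {M : ℕ} {x : Fin M → closure Ω}
    (ht : ∀ v ∈ trialSpace U x, dataNorm L Ω v ≤ 2 * ‖restrictData t v‖) {s : Fin M → U}
    (hs : IsNodalBasis x s) (a : Fin M → ℝ) :
    ‖a‖ ≤ 2 * γ * C * ‖stiffnessMatrix t s *ᵥ a‖ := by
  have hC := hp.1
  have hγ0 := hγ.1
  rw [stiffnessMatrix_mulVec]
  refine (pi_norm_le_iff_of_nonneg (by positivity)).2 fun j => ?_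
  have h1 := hγ.2 (∑ j, a j • s j) (x j)
  rw [hs.sum_smul_apply] at h1
  have h2 := mul_le_mul_of_nonneg_left
    (hp.le_norm_restrictData ht (hs.sum_smul_mem a)) hγ0.le
  rw [Real.norm_eq_abs]
  linarith

end Stability

end Collocation

/-! ### The collocation theorem -/

theorem mainTheorem8 {d : ℕ} (hd : 0 < d) (Ω : Set (Euc d)) (hopen : IsOpen Ω)
    (hbdd : Bornology.IsBounded Ω) (L : SecondOrderOperator d)
    (hL : L.IsUniformlyElliptic Ω) :
    -- well-posedness in the sup norm
    ((∀ x ∈ Ω, 0 ≤ L.c x) →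
      ∃ C : ℝ, 0 ≤ C ∧
        (∀ v : Euc d → ℝ, ContDiffOn ℝ 2 v Ω → ContinuousOn v (closure Ω) →
          ∀ F G : ℝ, (∀ x ∈ Ω, |L.apply v x| ≤ F) → (∀ y ∈ frontier Ω, |v y| ≤ G) →
            ∀ x ∈ closure Ω, |v x| ≤ C * max F G) ∧
        ∀ (U : Type u) [NormedAddCommGroup U] [InnerProductSpace ℝ U] [CompleteSpace U]
          [RKHS ℝ U (closure Ω) ℝ] (hU : IsCollocationSpace L Ω U),
          IsWellPosed L Ω (supSeminorm (hU.bddAbove_abs hbdd)) C ∧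
          PointEvaluationsBounded (supSeminorm (hU.bddAbove_abs hbdd)) 1) ∧
    -- the Sobolev spaces of order `m > 2 + d / 2` are admissible
    (∀ m : ℝ, 2 + (d : ℝ) / 2 < m →
      ∀ (U : Type u) [NormedAddCommGroup U] [InnerProductSpace ℝ U] [CompleteSpace U]
        [RKHS ℝ U (closure Ω) ℝ],
        range (fun v : U => (v : closure Ω → ℝ)) = sobolevFunctions m Ω →
        IsCollocationSpace L Ω U ∧
        ∀ (M : ℕ) (x : Fin M → closure Ω), Function.Injective x →
          LinearIndependent ℝ fun j => kernelTranslate U (x j)) ∧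
    -- choice of test functionals, uniform stability, error bounds and rates
    ∃ κ δ : ℝ, 0 < δ ∧
      ∀ (U : Type u) [NormedAddCommGroup U] [InnerProductSpace ℝ U] [CompleteSpace U]
        [RKHS ℝ U (closure Ω) ℝ], IsCollocationSpace L Ω U →
      ∀ (M : ℕ) (x : Fin M → closure Ω),
        (LinearIndependent ℝ fun j => kernelTranslate U (x j)) →
      (∃ s : Fin M → U, IsNodalBasis x s) ∧
      ∃ (N : ℕ) (t : Fin N → StrongDual ℝ U),
        (∀ k, t k ∈ dataFunctionals L Ω U) ∧
        (∀ v ∈ trialSpace U x, dataNorm L Ω v ≤ 2 * ‖restrictData t v‖) ∧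
        (∀ ustar : U, ∃ w ∈ trialSpace U x, ∀ v ∈ trialSpace U x,
          ‖restrictData t (ustar - w)‖ ≤ ‖restrictData t (ustar - v)‖) ∧
        ∀ (p : Seminorm ℝ U) (C γ : ℝ), IsWellPosed L Ω p C → PointEvaluationsBounded p γ →
        ∀ s : Fin M → U, IsNodalBasis x s →
          -- uniform stability of the stiffness matrix
          (∀ a : Fin M → ℝ, ‖a‖ ≤ 2 * γ * C * ‖stiffnessMatrix t s *ᵥ a‖) ∧
          -- error bounds for residual minimization up to a factor `CA`
          ∀ (ustar : U) (CA : ℝ), 1 ≤ CA → ∀ w ∈ trialSpace U x,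
            (∀ v ∈ trialSpace U x,
              ‖restrictData t (ustar - w)‖ ≤ CA * ‖restrictData t (ustar - v)‖ →
              p (ustar - w) ≤ C * (2 * CA + 3) * dataNorm L Ω (v - ustar)) ∧
            -- comparison with the interpolant `q` of the true solution
            ∀ q : U, q = ∑ j, ustar (x j) • s j →
              ‖restrictData t (ustar - w)‖ ≤ CA * ‖restrictData t (ustar - q)‖ →
              (∀ j, |ustar (x j) - w (x j)| ≤
                2 * γ * C * (1 + CA) * ‖restrictData t (ustar - q)‖) ∧
              (∀ S : ℝ, (∀ y ∈ Ω, ∀ k ≤ 2,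
                  ‖iteratedFDeriv ℝ k (extendZero (ustar - q)) y‖ ≤ S) →
                ∀ y : closure Ω, |ustar y - w y| ≤ γ * C * (2 * CA + 3) * κ * S) ∧
              (HasFiniteInnerDiameter Ω → FillDistanceLE Ω x δ →
                ∀ S : ℝ, (∀ y ∈ Ω, ‖iteratedFDeriv ℝ 2 (extendZero (ustar - q)) y‖ ≤ S) →
                ∀ y : closure Ω, |ustar y - w y| ≤ γ * C * (2 * CA + 3) * κ * S) := by
  refine ⟨fun hc => ?_, fun m hm U _ _ _ _ hrange => ⟨?_, fun M x hx => ?_⟩, ?_⟩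
  · obtain ⟨C, hC, h⟩ := hL.exists_abs_le_mul_max hd hopen hbdd hc
    exact ⟨C, hC, h, fun U _ _ _ _ hU => ⟨hU.isWellPosed_supSeminorm hopen _ hC h,
      pointEvaluationsBounded_supSeminorm _⟩⟩
  · refine isCollocationSpace_of_forall_exists_contDiff hopen hbdd hL fun v => ?_
    obtain ⟨V, hV, hvV⟩ : (v : closure Ω → ℝ) ∈ sobolevFunctions m Ω := hrange ▸ mem_range_self v
    exact ⟨V, hV.contDiff hm, hvV⟩
  · refine linearIndependent_kernelTranslate (fun V hV hVc => ?_) hx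
    have hmem : (fun x : closure Ω => V x) ∈ sobolevFunctions m Ω :=
      ⟨V, isSobolev_of_contDiff_of_hasCompactSupport m hV hVc, fun x => rfl⟩
    rw [← hrange] at hmem
    obtain ⟨v, hv⟩ := hmem
    exact ⟨v, fun x => congrFun hv x⟩
  obtain ⟨κ₁, hκ₁, hκL⟩ := hL.exists_abs_apply_le
  obtain ⟨κ₂, δ, hδ, hκδ⟩ : ∃ κ₂ δ : ℝ, 0 < δ ∧ (HasFiniteInnerDiameter Ω →
      ∀ (M : ℕ) (x : Fin M → closure Ω), FillDistanceLE Ω x δ →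
      ∀ v : Euc d → ℝ, ContDiffOn ℝ 2 v Ω → (∀ j, v (x j) = 0) →
      ∀ S : ℝ, (∀ y ∈ Ω, ‖iteratedFDeriv ℝ 2 v y‖ ≤ S) →
        ∀ y ∈ Ω, ∀ k ≤ 2, ‖iteratedFDeriv ℝ k v y‖ ≤ κ₂ * S) := by
    -- the constants must be fixed before the inner diameter is assumed finite
    by_cases h : HasFiniteInnerDiameter Ω
    · obtain ⟨κ₂, δ, hδ, h'⟩ := h.exists_norm_iteratedFDeriv_le hd hopen
      exact ⟨κ₂, δ, hδ, fun _ => h'⟩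
    · exact ⟨0, 1, one_pos, fun h' => absurd h' h⟩
  refine ⟨κ₁ * max 1 κ₂, δ, hδ, fun U _ _ _ _ hU M x hx => ⟨exists_isNodalBasis hx, ?_⟩⟩
  obtain ⟨N, t, htΛ, ht, hmin⟩ := hU.exists_testFunctionals (trialSpace U x)
  refine ⟨N, t, htΛ, ht, hmin, fun p C γ hp hγ s hs =>
    ⟨hp.norm_le_stiffnessMatrix hγ ht hs, fun u CA hCA w hw => ⟨fun v hv hres =>
      hp.error_le hU htΛ ht (by linarith) hv hw hres, ?_⟩⟩⟩
  rintro q rfl hres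
  set q : U := ∑ j, u (x j) • s j
  have hq : q ∈ trialSpace U x := hs.sum_smul_mem _
  have hqx : ∀ j, q (x j) = u (x j) := hs.sum_smul_apply fun j => u (x j)
  -- both rates follow from a bound for all derivatives of order at most two
  have hrate : ∀ S T : ℝ, (∀ y ∈ Ω, ∀ k ≤ 2, ‖iteratedFDeriv ℝ k (extendZero (u - q)) y‖ ≤ T) →
      T ≤ max 1 κ₂ * S →
      ∀ y : closure Ω, |u y - w y| ≤ γ * C * (2 * CA + 3) * (κ₁ * max 1 κ₂) * S := by
    intro S T hT hTS y
    obtain ⟨z, hz⟩ : Ω.Nonempty := closure_nonempty_iff.1 ⟨y, y.2⟩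
    have hT0 : 0 ≤ T := (norm_nonneg _).trans (hT z hz 0 (by norm_num))
    have hC := hp.1
    have hγ0 := hγ.1
    have h1 := hγ.2 (u - w) y
    rw [RKHS.coe_sub, Pi.sub_apply] at h1
    have h2 := hp.error_le hU htΛ ht (by linarith) hq hw hres
    have h3 := hU.dataNorm_le hκ₁ hκL hT0 hT
    rw [dataNorm_sub_comm] at h2
    calc |u y - w y| ≤ γ * (C * (2 * CA + 3) * (κ₁ * (max 1 κ₂ * S))) := by
          refine h1.trans (mul_le_mul_of_nonneg_left (h2.trans ?_) hγ0.le)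
          refine mul_le_mul_of_nonneg_left (h3.trans ?_) (mul_nonneg hC (by linarith))
          exact mul_le_mul_of_nonneg_left hTS (by linarith)
      _ = _ := by ring
  refine ⟨fun j => hp.abs_sub_le_of_eq hγ ht hq hw hres (hqx j), fun S hS y => ?_,
    fun hdiam hfill S hS y => ?_⟩
  · obtain ⟨z, hz⟩ : Ω.Nonempty := closure_nonempty_iff.1 ⟨y, y.2⟩
    have hS0 : 0 ≤ S := (norm_nonneg _).trans (hS z hz 0 (by norm_num))
    exact hrate S S hS (le_mul_of_one_le_left hS0 (le_max_left _ _)) y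
  · obtain ⟨z, hz⟩ : Ω.Nonempty := closure_nonempty_iff.1 ⟨y, y.2⟩
    have hS0 : 0 ≤ S := (norm_nonneg _).trans (hS z hz)
    refine hrate S (κ₂ * S) (hκδ hdiam M x hfill _ (hU.contDiffOn _) (fun j => ?_) S hS)
      (mul_le_mul_of_nonneg_right (le_max_right _ _) hS0) y
    rw [extendZero_apply_coe, RKHS.coe_sub, Pi.sub_apply, hqx, sub_self]
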